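/- Let $\gamma>1$, $0\le\mu\le 2$ and $0<R_0<R$, let $\rho_0,u_0\in C_0^\infty(\mathbb R)$ be supported in $\{|x|\le R\}$, and let $\varepsilon>0$ be such that $1+\varepsilon\rho_0>0$ on $\mathbb R$. Consider the one-dimensional isentropic Euler system with time-decayed damping $$\partial_t\rho+\partial_x(\rho u)=0,\qquad \partial_t(\rho u)+\partial_x(\rho u^2)+\partial_x p(\rho)=-\frac{\mu}{1+t}\,\rho u,\qquad \rho|_{t=0}=1+\varepsilon\rho_0,\quad u|_{t=0}=\varepsilon u_0,$$ where $p(\rho)=\frac1\gamma\rho^\gamma$. Let $T_\varepsilon\in[0,\infty]$ be the lifespan of $C^1$ solutions, i.e. the supremum of all $T$ for which there is a solution $(\rho,u)$ on $\mathbb R\times[0,T)$ that is $C^1$ up to $t=0$ and has $\rho>0$. Put $$q^0(r)=\int_r^\infty (x-r)^2\rho_0(x)\,dx,\qquad q^1(r)=2\int_r^\infty (x-r)\,\bigl(1+\varepsilon\rho_0(x)\bigr)u_0(x)\,dx,\qquad B_0=\frac12\int_{R_0}^R q^0(r)\,dr.$$ Suppose that $q^0(r)>0$ and $q^1(r)\ge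 0$ for all $R_0<r<R$. Then $T_\varepsilon<\infty$. If moreover $\gamma=2$, then $$T_\varepsilon\le C\exp\!\Bigl(\frac{C}{\varepsilon^2B_0^2}\Bigr),$$ where $C>0$ depends only on $\mu,R_0,R$. -/

import Mathlib

open scoped ENNReal ContDiff

noncomputable section

namespace DampedEuler

/-- The pressure law `p(ρ) = ρ ^ γ / γ` of a polytropic gas. -/
def pressure (γ ρ : ℝ) : ℝ := ρ ^ γ / γ

/-- The space-time slab `ℝ × [0, T)`; points are written `(x, t)`. The value `T = ∞` is allowed. -/
def slab (T : ℝ≥0∞) : Set (ℝ × ℝ) := {z | 0 ≤ z.2 ∧ ENNReal.ofReal z.2 < T}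

/-- `(ρ, u)` is a classical (`C¹`) solution on `ℝ × [0, T)`, without vacuum, of the isentropic
Euler equations with damping `μ / (1 + t)`, with initial values `1 + ε ρ₀` and `ε u₀`.
The functions are `C¹` up to `t = 0`; the equations are required for `0 < t < T`, where the
partial derivatives are two-sided, and so extend to `t = 0` by continuity. -/
structure IsC1Solution (γ μ ε : ℝ) (ρ₀ u₀ : ℝ → ℝ) (T : ℝ≥0∞) (ρ u : ℝ → ℝ → ℝ) : Prop where
  contDiffOn_density : ContDiffOn ℝ 1 (fun z : ℝ × ℝ => ρ z.1 z.2) (slab T)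
  contDiffOn_velocity : ContDiffOn ℝ 1 (fun z : ℝ × ℝ => u z.1 z.2) (slab T)
  density_pos : ∀ x t : ℝ, 0 ≤ t → ENNReal.ofReal t < T → 0 < ρ x t
  conservation_mass : ∀ x t : ℝ, 0 < t → ENNReal.ofReal t < T →
    deriv (fun s => ρ x s) t + deriv (fun y => ρ y t * u y t) x = 0
  balance_momentum : ∀ x t : ℝ, 0 < t → ENNReal.ofReal t < T →
    deriv (fun s => ρ x s * u x s) t + deriv (fun y => ρ y t * u y t ^ 2) x
      + deriv (fun y => pressure γ (ρ y t)) x = -(μ / (1 + t)) * (ρ x t * u x t)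
  initial_density : ∀ x : ℝ, ρ x 0 = 1 + ε * ρ₀ x
  initial_velocity : ∀ x : ℝ, u x 0 = ε * u₀ x

/-- The lifespan `T_ε ∈ [0, ∞]`: the supremum of all `T` for which a `C¹` solution exists on
`ℝ × [0, T)`. -/
def lifespan (γ μ ε : ℝ) (ρ₀ u₀ : ℝ → ℝ) : ℝ≥0∞ :=
  sSup {T : ℝ≥0∞ | ∃ ρ u : ℝ → ℝ → ℝ, IsC1Solution γ μ ε ρ₀ u₀ T ρ u}

/-- `q⁰(r) = ∫_r^∞ (x - r)² ρ₀(x) dx`. -/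
def q0 (ρ₀ : ℝ → ℝ) (r : ℝ) : ℝ := ∫ x in Set.Ioi r, (x - r) ^ 2 * ρ₀ x

/-- `q¹(r) = 2 ∫_r^∞ (x - r) (1 + ε ρ₀(x)) u₀(x) dx`; here `(1 + ε ρ₀) u₀` is the initial
momentum `ρ u` at time `0`, divided by `ε`. -/
def q1 (ε : ℝ) (ρ₀ u₀ : ℝ → ℝ) (r : ℝ) : ℝ :=
  2 * ∫ x in Set.Ioi r, (x - r) * ((1 + ε * ρ₀ x) * u₀ x)

/-- `B₀ = (1/2) ∫_{R₀}^{R} q⁰(r) dr`. -/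
def B0 (R₀ R : ℝ) (ρ₀ : ℝ → ℝ) : ℝ := (1 / 2) * ∫ r in R₀..R, q0 ρ₀ r

end DampedEuler

end

/-!
Write `μ = 2 κ` with `0 ≤ κ ≤ 1`, and normalize the pressure so that the sound speed at rest is
`1`. The density perturbation `ρ - 1` is tested against a solution `k` of the damped wave equation
`k_tt + (2 κ / (1 + t)) k_t = k_xx` which is positive in front of the cone `x = R₀ + t`, vanishes
behind it, and is homogeneous of degree `4 - κ` in `(x + 1 - R₀, 1 + t)`. Its profile is the
four-fold primitive of the Legendre function given by a hypergeometric series (`exists_legendre`,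
`exists_isProfile`). By finite speed of propagation (`SolvesOn.eq_rest`, a relative energy
estimate in trapezoids with slightly supersonic edges) the solution is at rest for `x > R + t`, so
that only the strip `R₀ + t ≤ x ≤ R + t` of constant width contributes.

In the main functional `Y = (1 + t) ^ (2 κ) ∫ (ρ u k_x - (ρ - 1) k_t)` all linear terms of the
equations cancel, and `Y' = (1 + t) ^ (2 κ) ∫ (ρ u² + p(ρ) - p(1) - (ρ - 1)) k_xx ≥ 0`
(`SolvesOn.hasDerivAt_main`). With `A = (1 + t) ^ (2 κ) ∫ (ρ - 1) k` and
`B = -(1 + t) ^ (2 κ) ∫ (ρ - 1) k_t` one has `A' = Y - 2 B + (2 κ / (1 + t)) A`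
(`SolvesOn.hasDerivAt_waveFunctional`). The pressure is strictly convex, and its excess over the
tangent at `1` is bounded below by affine functions of `|ρ - 1|` of every slope
(`exists_mul_abs_sub_le_excess`); in the strip the wave and its time derivative are bounded by
`k_xx` (`IsProfile.wave_bounds`). Hence `Y'` controls `|A| + |B|` superlinearly, with the weight
`1 / (1 + t)` (`SolvesOn.le_integral_production`).

This closed system forces `Y` to double along a sequence of times whose logarithms are the partial
sums of a convergent geometric series, of sum `C / min 1 Y(0)`, so that a solution cannot exist
beyond the limit of these times (`log_lifespan_le`). Finally, integrations by parts write `Y(0)`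
as `ε` times integrals of `q⁰` and `q¹` against nonnegative weights, which gives `Y(0) ≥ ε B₀ / 2`
(`le_main_zero`). The resulting bound `log (1 + T) ≤ C / min 1 (ε B₀ / 2)` holds for every
`γ > 1`, and implies the one claimed for `γ = 2`.
-/

namespace DampedEuler

open Set Filter Topology MeasureTheory

/-! ### A differential inequality of Riccati type -/

/-- Doubling step for the differential inequalities of `log_lifespan_le`: if `1 + t` grows by the
factor `e ^ m` between `t₁` and `t₂`, and `m` is not too small compared with `y ≤ Y t₁`, then `Y`
grows by at least `y`. -/
lemma add_le_of_riccati_system {q : ℕ} {K κ T₁ t₁ t₂ m y θ : ℝ} (hκ0 : 0 ≤ κ)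
    (hκ1 : κ ≤ 1) {Y A B : ℝ → ℝ}
    (hYc : ContinuousOn Y (Icc 0 T₁)) (hAc : ContinuousOn A (Icc 0 T₁))
    (hY : ∀ t ∈ Ioo 0 T₁, ∃ Y' : ℝ, HasDerivAt Y Y' t ∧ 0 ≤ Y' ∧
      ∀ θ : ℝ, 0 ≤ θ → 1 / (1 + t) * (θ * (|A t| + |B t|) - K * (θ ^ 2 + θ ^ q)) ≤ Y')
    (hA : ∀ t ∈ Ioo 0 T₁, HasDerivAt A (Y t - 2 * B t + 2 * κ / (1 + t) * A t) t)
    (h1 : 0 ≤ t₁) (h12 : t₁ ≤ t₂) (h2 : t₂ ≤ T₁) (hm : 0 < m)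
    (hmt : Real.log (1 + t₂) = Real.log (1 + t₁) + m) (hy1 : y ≤ Y t₁)
    (hmono : MonotoneOn Y (Icc 0 T₁)) (hθ : θ = 12 * (1 + m) / m ^ 2)
    (hN : K * (θ ^ 2 + θ ^ q) * m ≤ y) :
    Y t₁ + y ≤ Y t₂ := by
  have hθ0 : 0 < θ := by rw [hθ]; positivity
  set N := K * (θ ^ 2 + θ ^ q) with hNdef
  set D := m + m ^ 2 with hD
  have hD0 : 0 < D := by positivity
  let s : ℝ → ℝ := fun t => Real.log (1 + t) - Real.log (1 + t₁)
  -- With the bump `s (m - s) / (1 + t)` in logarithmic time, `J` is nondecreasing: in its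
  -- derivative the terms in `A` and `B` are absorbed by the growth of `Y`, and the bump times
  -- `Y ≥ y` pays for the last term, a primitive of `y s (m - s) / (1 + t)`.
  let J : ℝ → ℝ := fun t => s t * (m - s t) / (1 + t) * A t + D / θ * (Y t + N * s t)
    - y * (m * s t ^ 2 / 2 - s t ^ 3 / 3)
  have hsub : Icc t₁ t₂ ⊆ Icc 0 T₁ := Icc_subset_Icc h1 h2
  have hsubo : Ioo t₁ t₂ ⊆ Ioo 0 T₁ := Ioo_subset_Ioo h1 h2
  have hsc : ContinuousOn s (Icc t₁ t₂) := by
    refine ContinuousOn.sub (ContinuousOn.log (by fun_prop) ?_) continuousOn_const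
    intro x hx
    have := hx.1
    exact (by linarith : 0 < 1 + x).ne'
  have hJc : ContinuousOn J (Icc t₁ t₂) := by
    have e1 := hAc.mono hsub
    have e2 := hYc.mono hsub
    have e3 : ContinuousOn (fun t : ℝ => s t * (m - s t) / (1 + t)) (Icc t₁ t₂) := by
      refine ContinuousOn.div (by fun_prop) (by fun_prop) ?_
      intro x hx
      have := hx.1
      exact (by linarith : 0 < 1 + x).ne'
    fun_prop
  have hder : ∀ t ∈ Ioo t₁ t₂, ∃ J' : ℝ, HasDerivAt J J' t ∧ 0 ≤ J' := by
    intro t ht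
    obtain ⟨Y', hY', -, hYθ⟩ := hY t (hsubo ht)
    have hA' := hA t (hsubo ht)
    have ht1 := ht.1
    have hτ : 0 < 1 + t := by linarith
    have hτ1 : 1 ≤ 1 + t := by linarith
    have hs' : HasDerivAt s (1 / (1 + t)) t := by
      have := ((hasDerivAt_id t).const_add 1).log hτ.ne'
      simpa [s] using this.sub_const (Real.log (1 + t₁))
    have hs0 : 0 ≤ s t := by
      have : Real.log (1 + t₁) ≤ Real.log (1 + t) :=
        Real.log_le_log (by linarith) (by linarith)
      simpa [s] using this
    have hsm : s t ≤ m := by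
      have : Real.log (1 + t) ≤ Real.log (1 + t₂) :=
        Real.log_le_log (by linarith) (by linarith [ht.2])
      simp only [s]; linarith
    have hη0 : 0 ≤ s t * (m - s t) := mul_nonneg hs0 (by linarith)
    have hη1 : s t * (m - s t) ≤ m ^ 2 / 4 := by nlinarith [sq_nonneg (2 * s t - m)]
    have hJ' := ((((hs'.mul (hs'.const_sub m)).div ((hasDerivAt_id t).const_add 1)
      hτ.ne').mul hA').add
      ((hY'.add (hs'.const_mul N)).const_mul (D / θ))).sub
      ((((hs'.pow 2).const_mul m).div_const 2 |>.sub ((hs'.pow 3).div_const 3)).const_mul y)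
    refine ⟨_, hJ', ?_⟩
    have hYt : y ≤ Y t := hy1.trans
      (hmono (hsub (left_mem_Icc.2 h12)) (hsub ⟨ht.1.le, ht.2.le⟩) ht.1.le)
    have hY1 := hYθ θ hθ0.le
    rw [← hNdef] at hY1
    have hY2 : D / (1 + t) * (|A t| + |B t|) ≤ D / θ * (Y' + N * (1 / (1 + t))) := by
      have : D / θ * (1 / (1 + t) * (θ * (|A t| + |B t|) - N) + N * (1 / (1 + t)))
          ≤ D / θ * (Y' + N * (1 / (1 + t))) := by gcongr
      refine le_trans (le_of_eq ?_) this
      field_simp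
      ring
    -- the coefficients of `A` and `B` in the derivative are at most `D / (1 + t)`
    have hcA : |(m - 2 * s t - s t * (m - s t) + 2 * κ * (s t * (m - s t))) / (1 + t) ^ 2|
        ≤ D / (1 + t) := by
      rw [abs_div, abs_of_pos (by positivity : 0 < (1 + t) ^ 2)]
      have hnum : |m - 2 * s t - s t * (m - s t) + 2 * κ * (s t * (m - s t))| ≤ D := by
        have : κ * (s t * (m - s t)) ≤ s t * (m - s t) := by nlinarith
        have : 0 ≤ κ * (s t * (m - s t)) := by positivity
        rw [abs_le]
        constructor <;> nlinarith
      calc _ ≤ D / (1 + t) ^ 2 := by gcongr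
        _ ≤ D / (1 + t) := by
          apply div_le_div_of_nonneg_left hD0.le hτ
          nlinarith
    have hcB : 2 * (s t * (m - s t)) / (1 + t) ≤ D / (1 + t) := by
      gcongr
      nlinarith
    have e1 : -(D / (1 + t) * |A t|) ≤
        (m - 2 * s t - s t * (m - s t) + 2 * κ * (s t * (m - s t))) / (1 + t) ^ 2 * A t := by
      have := neg_abs_le
        ((m - 2 * s t - s t * (m - s t) + 2 * κ * (s t * (m - s t))) / (1 + t) ^ 2 * A t)
      rw [abs_mul] at this
      have := mul_le_mul_of_nonneg_right hcA (abs_nonneg (A t))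
      linarith
    have e2 : -(D / (1 + t) * |B t|) ≤ -(2 * (s t * (m - s t)) / (1 + t) * B t) := by
      have h0 : 0 ≤ 2 * (s t * (m - s t)) / (1 + t) := by positivity
      have h3 := mul_le_mul_of_nonneg_left (le_abs_self (B t)) h0
      have h4 := mul_le_mul_of_nonneg_right hcB (abs_nonneg (B t))
      linarith
    have e3 : s t * (m - s t) / (1 + t) * y ≤ s t * (m - s t) / (1 + t) * Y t := by
      gcongr
    have key : 0 ≤ (m - 2 * s t - s t * (m - s t) + 2 * κ * (s t * (m - s t))) / (1 + t) ^ 2 * A t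
        + s t * (m - s t) / (1 + t) * Y t - 2 * (s t * (m - s t)) / (1 + t) * B t
        + D / θ * (Y' + N * (1 / (1 + t))) - s t * (m - s t) / (1 + t) * y := by
      have : D / (1 + t) * (|A t| + |B t|) = D / (1 + t) * |A t| + D / (1 + t) * |B t| := by ring
      linarith
    refine key.trans (le_of_eq ?_)
    simp only [id, Pi.mul_apply, Pi.div_apply]
    generalize A t = a
    generalize Y t = Yt
    generalize B t = b
    generalize s t = σ
    generalize D / θ * (Y' + N * (1 / (1 + t))) = c
    clear * - hτ
    push_cast
    field_simp
    ring
  have hJm : MonotoneOn J (Icc t₁ t₂) := by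
    apply monotoneOn_of_deriv_nonneg (convex_Icc _ _) hJc
    · rw [interior_Icc]
      intro t ht
      obtain ⟨J', hJ', -⟩ := hder t ht
      exact hJ'.differentiableAt.differentiableWithinAt
    · rw [interior_Icc]
      intro t ht
      obtain ⟨J', hJ', h0⟩ := hder t ht
      rwa [hJ'.deriv]
  have hfin := hJm (left_mem_Icc.2 h12) (right_mem_Icc.2 h12) h12
  have hs1 : s t₁ = 0 := by simp [s]
  have hs2 : s t₂ = m := by simp only [s]; linarith
  simp only [J, hs1, hs2] at hfin
  -- the bump vanishes at both ends, so no information on `A` is needed there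
  have h3 : y * m ^ 3 / 6 ≤ D / θ * (Y t₂ - Y t₁ + N * m) := by
    have e : D / θ * (Y t₂ - Y t₁ + N * m) - y * m ^ 3 / 6 =
        (m * (m - m) / (1 + t₂) * A t₂ + D / θ * (Y t₂ + N * m)
          - y * (m * m ^ 2 / 2 - m ^ 3 / 3))
        - (0 * (m - 0) / (1 + t₁) * A t₁ + D / θ * (Y t₁ + N * 0)
          - y * (m * 0 ^ 2 / 2 - 0 ^ 3 / 3)) := by ring
    rw [← sub_nonneg, e]
    exact sub_nonneg.2 hfin
  have hDθ : D / θ = m ^ 3 / 12 := by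
    rw [hθ, hD]
    field_simp
  rw [hDθ] at h3
  have h4 : 0 < m ^ 3 := by positivity
  have h5 : m ^ 3 * (2 * y) ≤ m ^ 3 * (Y t₂ - Y t₁ + N * m) := by linarith
  have h6 := le_of_mul_le_mul_left h5 h4
  linarith

/-- A Bernoulli-type choice of ratio: `1 - 1 / (2 N)` has `N`-th power at least `1 / 2`. -/
lemma half_le_one_sub_pow {N : ℕ} (hN : 1 ≤ N) : (1 : ℝ) / 2 ≤ (1 - 1 / (2 * N)) ^ N := by
  have hN' : (1 : ℝ) ≤ N := by exact_mod_cast hN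
  have h : (-2 : ℝ) ≤ -(1 / (2 * N)) := by
    have : (1 : ℝ) / (2 * N) ≤ 1 := by
      rw [div_le_one (by positivity)]; linarith
    linarith
  have := one_add_mul_le_pow h N
  have e : 1 + (N : ℝ) * -(1 / (2 * N)) = 1 / 2 := by field_simp; norm_num
  rw [e] at this
  simpa [sub_eq_add_neg] using this

/-- With `θ = 12 (1 + m) / m²`, the admissible defect `K (θ² + θ ^ q) m` is controlled by the two
extreme powers of `1 / m`. -/
lemma defect_le {q : ℕ} (hq : 2 ≤ q) {m : ℝ} (hm : 0 < m) :
    ((12 * (1 + m) / m ^ 2) ^ 2 + (12 * (1 + m) / m ^ 2) ^ q) * m ≤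
      4 * 24 ^ q * (1 / m + (1 / m) ^ (2 * q - 1)) := by
  obtain ⟨n, rfl⟩ : ∃ n, q = n + 2 := ⟨q - 2, by omega⟩
  have hv : 0 < 1 / m := by positivity
  set v := 1 / m with hvdef
  have hmv : m * v = 1 := by rw [hvdef]; field_simp
  have e : 12 * (1 + m) / m ^ 2 = 12 * (v * (1 + v)) := by
    rw [hvdef]; field_simp; ring
  have hmid : ∀ j : ℕ, 1 ≤ j → j ≤ 2 * (n + 2) - 1 → v ^ j ≤ v + v ^ (2 * (n + 2) - 1) := by
    intro j h1 h2
    rcases le_total v 1 with h | h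
    · have := pow_le_pow_of_le_one hv.le h h1
      have h' : 0 ≤ v ^ (2 * (n + 2) - 1) := by positivity
      rw [pow_one] at this
      linarith
    · have := pow_le_pow_right₀ h h2
      linarith
  have hgen : ∀ p : ℕ, 2 ≤ p → p ≤ n + 2 →
      (12 * (v * (1 + v))) ^ p * m ≤ 2 * 24 ^ (n + 2) * (v + v ^ (2 * (n + 2) - 1)) := by
    intro p hp hpn
    have h1 : (1 + v) ^ p ≤ 2 ^ p * (1 + v ^ p) := by
      rcases le_total v 1 with h | h
      · have : (1 + v) ^ p ≤ 2 ^ p := pow_le_pow_left₀ (by positivity) (by linarith) p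
        have : 0 ≤ (2 : ℝ) ^ p * v ^ p := by positivity
        linarith
      · have : (1 + v) ^ p ≤ (2 * v) ^ p := pow_le_pow_left₀ (by positivity) (by linarith) p
        rw [mul_pow] at this
        have : 0 ≤ (2 : ℝ) ^ p := by positivity
        linarith
    have h2 : v ^ p * m = v ^ (p - 1) := by
      obtain ⟨p', rfl⟩ : ∃ p', p = p' + 1 := ⟨p - 1, by omega⟩
      rw [pow_succ, mul_assoc, mul_comm v m, hmv]; simp
    calc (12 * (v * (1 + v))) ^ p * m = 12 ^ p * (v ^ p * m) * (1 + v) ^ p := by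
          rw [mul_pow, mul_pow]; ring
      _ ≤ 12 ^ p * v ^ (p - 1) * (2 ^ p * (1 + v ^ p)) := by rw [h2]; gcongr
      _ = 24 ^ p * (v ^ (p - 1) + v ^ (p - 1 + p)) := by
          rw [pow_add, show (24 : ℝ) = 12 * 2 by norm_num, mul_pow]; ring
      _ ≤ 24 ^ (n + 2) * ((v + v ^ (2 * (n + 2) - 1)) + (v + v ^ (2 * (n + 2) - 1))) := by
          gcongr
          · norm_num
          · exact hmid _ (by omega) (by omega)
          · exact hmid _ (by omega) (by omega)
      _ = _ := by ring
  rw [e, add_mul]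
  have a1 := hgen 2 le_rfl (by omega)
  have a2 := hgen (n + 2) (by omega) le_rfl
  linarith

/-- Blow-up for a damped second-order system of Riccati type: it can only be solved as long as
`log (1 + t) ≤ C / y₀`, where `y₀ ∈ (0, 1]` is a lower bound for `Y 0`. Indeed `Y` doubles on
successive intervals whose lengths in `log (1 + t)` form a geometric sequence. -/
theorem log_lifespan_le {q : ℕ} (hq : 2 ≤ q) {K : ℝ} (hK : 0 < K) :
    ∃ C : ℝ, 0 < C ∧ ∀ (κ T₁ y₀ : ℝ) (Y A B : ℝ → ℝ), 0 ≤ κ → κ ≤ 1 → 0 ≤ T₁ → 0 < y₀ → y₀ ≤ 1 →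
      ContinuousOn Y (Icc 0 T₁) → ContinuousOn A (Icc 0 T₁) →
      (∀ t ∈ Ioo 0 T₁, ∃ Y' : ℝ, HasDerivAt Y Y' t ∧ 0 ≤ Y' ∧
        ∀ θ : ℝ, 0 ≤ θ → 1 / (1 + t) * (θ * (|A t| + |B t|) - K * (θ ^ 2 + θ ^ q)) ≤ Y') →
      (∀ t ∈ Ioo 0 T₁, HasDerivAt A (Y t - 2 * B t + 2 * κ / (1 + t) * A t) t) →
      y₀ ≤ Y 0 → Real.log (1 + T₁) ≤ C / y₀ := by
  set N := 2 * q - 1 with hN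
  have hN1 : 1 ≤ N := by omega
  have hN1' : (1 : ℝ) ≤ N := by exact_mod_cast hN1
  -- A ratio below `1`, for which the defect, of order `(1 / m) ^ N`, at most doubles when `m` is
  -- multiplied by `r`.
  set r : ℝ := 1 - 1 / (2 * N) with hr
  have hrN : 1 / 2 ≤ r ^ N := half_le_one_sub_pow hN1
  have hr1 : r < 1 := by
    have : (0 : ℝ) < 1 / (2 * N) := by positivity
    linarith
  have hr2 : 1 / 2 ≤ r := by
    have : (1 : ℝ) / (2 * N) ≤ 1 / 2 := by
      apply div_le_div_of_nonneg_left <;> linarith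
    linarith
  have hr0 : 0 < r := by linarith
  set C₃ : ℝ := 4 * 24 ^ q with hC₃
  set C₁ : ℝ := max 1 (2 * K * C₃) with hC₁
  have hC1 : 1 ≤ C₁ := le_max_left _ _
  have hC2 : 2 * K * C₃ ≤ C₁ := le_max_right _ _
  have hC0 : 0 < C₁ := by linarith
  refine ⟨C₁ / (1 - r), div_pos hC0 (by linarith), ?_⟩
  intro κ T₁ y₀ Y A B hκ0 hκ1 hT hy0 hy1 hYc hAc hY hA hY0
  by_contra! hcon
  have hmono : MonotoneOn Y (Icc 0 T₁) := by
    apply monotoneOn_of_deriv_nonneg (convex_Icc _ _) hYc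
    · rw [interior_Icc]
      intro t ht
      obtain ⟨Y', hY', -⟩ := hY t ht
      exact hY'.differentiableAt.differentiableWithinAt
    · rw [interior_Icc]
      intro t ht
      obtain ⟨Y', hY', h0, -⟩ := hY t ht
      rwa [hY'.deriv]
  let m : ℕ → ℝ := fun k => C₁ / y₀ * r ^ k
  let S : ℕ → ℝ := fun k => ∑ i ∈ Finset.range k, m i
  let t : ℕ → ℝ := fun k => Real.exp (S k) - 1
  have hm0 : ∀ k, 0 < m k := fun k => by positivity
  have hS0 : ∀ k, 0 ≤ S k := fun k => Finset.sum_nonneg fun i _ => (hm0 i).le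
  have hSlt : ∀ k, S k < Real.log (1 + T₁) := by
    intro k
    refine lt_of_le_of_lt ?_ hcon
    simp only [S, m]
    rw [← Finset.mul_sum, geom_sum_eq hr1.ne]
    have h1r : 0 < 1 - r := by linarith
    have : (r ^ k - 1) / (r - 1) ≤ 1 / (1 - r) := by
      rw [← neg_div_neg_eq]
      have : 0 < r ^ k := by positivity
      have e : -(r - 1) = 1 - r := by ring
      rw [e]
      gcongr
      linarith
    calc C₁ / y₀ * ((r ^ k - 1) / (r - 1)) ≤ C₁ / y₀ * (1 / (1 - r)) := by gcongr
      _ = C₁ / (1 - r) / y₀ := by field_simp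
  have htlog : ∀ k, Real.log (1 + t k) = S k := fun k => by simp [t]
  have ht0 : ∀ k, 0 ≤ t k := fun k => by
    have := Real.add_one_le_exp (S k)
    have := hS0 k
    simp only [t]; linarith
  have htT : ∀ k, t k ≤ T₁ := fun k => by
    have := (Real.lt_log_iff_exp_lt (by linarith)).1 (hSlt k)
    simp only [t]; linarith
  have htm : ∀ k, t k ≤ t (k + 1) := fun k => by
    have : S k ≤ S (k + 1) := by
      simp only [S, Finset.sum_range_succ]
      linarith [hm0 k]
    simp only [t]
    have := Real.exp_le_exp.2 this
    linarith
  have hgrow : ∀ k : ℕ, 2 ^ k * y₀ ≤ Y (t k) := by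
    intro k
    induction k with
    | zero => simpa [t, S] using hY0
    | succ k ih =>
      have hstep := add_le_of_riccati_system (m := m k) (y := 2 ^ k * y₀)
        (θ := 12 * (1 + m k) / m k ^ 2) hκ0 hκ1 hYc hAc hY hA
        (ht0 k) (htm k) (htT (k + 1)) (hm0 k) ?_ ih hmono rfl ?_
      · calc 2 ^ (k + 1) * y₀ = 2 ^ k * y₀ + 2 ^ k * y₀ := by ring
          _ ≤ _ := by linarith
      · rw [htlog, htlog]
        simp only [S, Finset.sum_range_succ]
      · have hdef := defect_le hq (hm0 k)
        rw [← hC₃, ← hN] at hdef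
        have hv1 : 1 / m k ≤ y₀ / C₁ * 2 ^ k := by
          have : (1 / 2 : ℝ) ^ k ≤ r ^ k := by gcongr
          rw [div_le_iff₀ (hm0 k)]
          have e : y₀ / C₁ * 2 ^ k * m k = 2 ^ k * r ^ k := by
            simp only [m]; field_simp
          rw [e]
          calc (1 : ℝ) = 2 ^ k * (1 / 2) ^ k := by rw [← mul_pow]; norm_num
            _ ≤ _ := by gcongr
        have hv2 : (1 / m k) ^ N ≤ y₀ / C₁ * 2 ^ k := by
          have hz : y₀ / C₁ ≤ 1 := by
            rw [div_le_one hC0]; linarith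
          have hz0 : 0 < y₀ / C₁ := by positivity
          have e : (1 / m k) ^ N = (y₀ / C₁) ^ N * (1 / r ^ N) ^ k := by
            simp only [m]
            rw [show 1 / (C₁ / y₀ * r ^ k) = y₀ / C₁ * (1 / r ^ k) by field_simp, mul_pow]
            congr 1
            rw [div_pow, div_pow, one_pow, one_pow, ← pow_mul, ← pow_mul, mul_comm]
          rw [e]
          have h2 : 1 / r ^ N ≤ 2 := by
            rw [div_le_iff₀ (by positivity)]; linarith
          have h3 : (y₀ / C₁) ^ N ≤ y₀ / C₁ := pow_le_of_le_one hz0.le hz (by omega)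
          gcongr
        calc K * ((12 * (1 + m k) / m k ^ 2) ^ 2 + (12 * (1 + m k) / m k ^ 2) ^ q) * m k
            = K * (((12 * (1 + m k) / m k ^ 2) ^ 2 + (12 * (1 + m k) / m k ^ 2) ^ q) * m k) := by
              ring
          _ ≤ K * (C₃ * (1 / m k + (1 / m k) ^ N)) := by gcongr
          _ ≤ K * (C₃ * (y₀ / C₁ * 2 ^ k + y₀ / C₁ * 2 ^ k)) := by gcongr
          _ = 2 * K * C₃ / C₁ * (2 ^ k * y₀) := by field_simp; ring
          _ ≤ 1 * (2 ^ k * y₀) := by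
              gcongr
              rw [div_le_one hC0]; exact hC2
          _ = _ := one_mul _
  obtain ⟨k, hk⟩ := pow_unbounded_of_one_lt (Y T₁ / y₀) (one_lt_two : (1 : ℝ) < 2)
  rw [div_lt_iff₀ hy0] at hk
  have h1 := hmono ⟨ht0 k, htT k⟩ (right_mem_Icc.2 hT) (htT k)
  have h2 := hgrow k
  linarith

/-! ### Convexity of the pressure and energy flux -/

/-- The excess `p(ρ) - p(1) - p'(1) (ρ - 1)` of the pressure over its tangent at `ρ = 1`. -/
noncomputable def excess (γ ρ : ℝ) : ℝ := pressure γ ρ - 1 / γ - (ρ - 1)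

/-- Convexity of the pressure law: the excess lies above each of its tangents. -/
lemma tangent_le_excess {γ ρ ρ₁ : ℝ} (hγ : 1 < γ) (hρ : 0 < ρ) (hρ₁ : 0 < ρ₁) :
    excess γ ρ₁ + (ρ₁ ^ (γ - 1) - 1) * (ρ - ρ₁) ≤ excess γ ρ := by
  have hb := one_add_mul_self_le_rpow_one_add (s := ρ / ρ₁ - 1) (p := γ)
    (by have := div_pos hρ hρ₁; linarith) hγ.le
  rw [add_sub_cancel, Real.div_rpow hρ.le hρ₁.le, le_div_iff₀ (by positivity)] at hb
  have e : ρ₁ ^ γ = ρ₁ ^ (γ - 1) * ρ₁ := by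
    rw [← Real.rpow_add_one hρ₁.ne']; simp
  have e2 : (1 + γ * (ρ / ρ₁ - 1)) * ρ₁ ^ γ = ρ₁ ^ γ + γ * ρ₁ ^ (γ - 1) * (ρ - ρ₁) := by
    rw [e]; field_simp
  rw [e2] at hb
  have hγ0 : 0 < γ := by linarith
  unfold excess pressure
  have : (ρ₁ ^ γ + γ * ρ₁ ^ (γ - 1) * (ρ - ρ₁)) / γ ≤ ρ ^ γ / γ := by gcongr
  have e3 : (ρ₁ ^ γ + γ * ρ₁ ^ (γ - 1) * (ρ - ρ₁)) / γ =
      ρ₁ ^ γ / γ + ρ₁ ^ (γ - 1) * (ρ - ρ₁) := by field_simp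
  rw [e3] at this
  linarith

@[simp] lemma excess_one (γ : ℝ) : excess γ 1 = 0 := by simp [excess, pressure]

lemma excess_nonneg {γ ρ : ℝ} (hγ : 1 < γ) (hρ : 0 < ρ) : 0 ≤ excess γ ρ := by
  simpa using tangent_le_excess hγ hρ one_pos

lemma one_add_pow_le {θ : ℝ} (h0 : 0 ≤ θ) (n : ℕ) :
    (1 + θ) ^ n ≤ 1 + 2 ^ n * (θ + θ ^ n) := by
  rcases le_total θ 1 with h | h
  · have : (1 + θ) ^ n ≤ 1 + (2 ^ n - 1) * θ := by
      induction n with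
      | zero => simp
      | succ n ih =>
        have h2 : (1 : ℝ) ≤ 2 ^ n := one_le_pow₀ (by norm_num)
        calc (1 + θ) ^ (n + 1) = (1 + θ) ^ n * (1 + θ) := pow_succ _ _
          _ ≤ (1 + (2 ^ n - 1) * θ) * (1 + θ) := by gcongr
          _ ≤ _ := by
            rw [pow_succ]
            nlinarith [mul_nonneg (mul_nonneg (sub_nonneg.2 h2) h0) (sub_nonneg.2 h)]
    have h3 : 0 ≤ (2 : ℝ) ^ n * θ ^ n := by positivity
    nlinarith
  · have : (1 + θ) ^ n ≤ (2 * θ) ^ n := pow_le_pow_left₀ (by positivity) (by linarith) n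
    rw [mul_pow] at this
    have h3 : 0 ≤ (2 : ℝ) ^ n * θ := by positivity
    nlinarith

/-- Lower bounds of the excess by affine functions of `|ρ - 1|` with arbitrary slope `θ`. They
encode, without case distinctions on `γ`, that the excess is quadratic near `ρ = 1` and grows
faster than linearly. -/
lemma exists_mul_abs_sub_le_excess {γ : ℝ} (hγ : 1 < γ) :
    ∃ (q : ℕ) (C : ℝ), 2 ≤ q ∧ 0 < C ∧ ∀ θ ρ : ℝ, 0 ≤ θ → 0 < ρ →
      θ * |ρ - 1| - C * (θ ^ 2 + θ ^ q) ≤ excess γ ρ := by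
  obtain ⟨n, hn⟩ := exists_nat_ge (max 1 (1 / (γ - 1)))
  have hn1 : (1 : ℝ) ≤ n := (le_max_left _ _).trans hn
  have hns : 1 / (γ - 1) ≤ n := (le_max_right _ _).trans hn
  have hn1' : 1 ≤ n := by exact_mod_cast hn1
  have hγ1 : 0 < γ - 1 := by linarith
  have h2n : (n : ℝ) ≤ 2 ^ n := by exact_mod_cast (Nat.lt_two_pow_self (n := n)).le
  refine ⟨n + 1, 2 ^ n, by omega, by positivity, ?_⟩
  intro θ ρ hθ hρ
  have hpow : 0 ≤ θ ^ (n + 1) := by positivity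
  have h2pos : (1 : ℝ) ≤ 2 ^ n := one_le_pow₀ (by norm_num)
  rcases le_total 1 ρ with h | h
  · -- tangent at the point where the slope of the excess is `θ`
    have ht := tangent_le_excess hγ hρ (ρ₁ := (1 + θ) ^ (1 / (γ - 1))) (by positivity)
    rw [← Real.rpow_mul (by positivity), one_div_mul_cancel hγ1.ne', Real.rpow_one] at ht
    have h1 := excess_nonneg hγ (ρ := (1 + θ) ^ (1 / (γ - 1))) (by positivity)
    have h3 : (1 + θ) ^ (1 / (γ - 1)) ≤ (1 + θ) ^ n := by
      rw [← Real.rpow_natCast]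
      exact Real.rpow_le_rpow_of_exponent_le (by linarith) hns
    have h4 := h3.trans (one_add_pow_le hθ n)
    have h5 : θ * (1 + θ) ^ (1 / (γ - 1)) ≤ θ * (1 + 2 ^ n * (θ + θ ^ n)) := by gcongr
    rw [abs_of_nonneg (by linarith)]
    have e : θ * (1 + 2 ^ n * (θ + θ ^ n)) = θ + 2 ^ n * (θ ^ 2 + θ ^ (n + 1)) := by ring
    linarith
  · rw [abs_of_nonpos (by linarith)]
    rcases lt_or_ge θ 1 with h1 | h1
    · have hp : 0 < 1 - θ := by linarith
      -- tangent at the point where the slope of the excess is `-θ`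
      have ht := tangent_le_excess hγ hρ (ρ₁ := (1 - θ) ^ (1 / (γ - 1))) (by positivity)
      rw [← Real.rpow_mul hp.le, one_div_mul_cancel hγ1.ne', Real.rpow_one] at ht
      have h1 := excess_nonneg hγ (ρ := (1 - θ) ^ (1 / (γ - 1))) (by positivity)
      have h3 : (1 - θ) ^ n ≤ (1 - θ) ^ (1 / (γ - 1)) := by
        rw [← Real.rpow_natCast]
        exact Real.rpow_le_rpow_of_exponent_ge hp (by linarith) hns
      have h4 := one_add_mul_le_pow (a := -θ) (by linarith) n
      have h5 : 1 - n * θ ≤ (1 - θ) ^ (1 / (γ - 1)) := by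
        refine le_trans (le_of_eq (by ring)) (h4.trans (le_trans (le_of_eq (by ring_nf)) h3))
      have h6 : θ * (1 - n * θ) ≤ θ * (1 - θ) ^ (1 / (γ - 1)) := by gcongr
      have h7 : (n : ℝ) * θ ^ 2 ≤ 2 ^ n * θ ^ 2 := by gcongr
      have h8 : 0 ≤ 2 ^ n * θ ^ (n + 1) := by positivity
      nlinarith
    · have h2 := excess_nonneg hγ hρ
      have h8 : 0 ≤ 2 ^ n * θ ^ (n + 1) := by positivity
      nlinarith [mul_nonneg hθ hρ.le]

lemma excess_pos {γ ρ : ℝ} (hγ : 1 < γ) (hρ : 0 < ρ) (h1 : ρ ≠ 1) : 0 < excess γ ρ := by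
  have hb := one_add_mul_self_lt_rpow_one_add (s := ρ - 1) (p := γ) (by linarith)
    (sub_ne_zero.2 h1) hγ
  rw [add_sub_cancel] at hb
  have hγ0 : 0 < γ := by linarith
  have : (1 + γ * (ρ - 1)) / γ < ρ ^ γ / γ := by gcongr
  have e : (1 + γ * (ρ - 1)) / γ = 1 / γ + (ρ - 1) := by field_simp
  unfold excess pressure
  linarith

/-- Kinetic plus internal energy of a state, relative to the rest state `ρ = 1`, `u = 0`. -/
noncomputable def energy (γ ρ u : ℝ) : ℝ := ρ * u ^ 2 / 2 + excess γ ρ / (γ - 1)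

lemma energy_nonneg {γ ρ u : ℝ} (hγ : 1 < γ) (hρ : 0 < ρ) : 0 ≤ energy γ ρ u := by
  have := excess_nonneg hγ hρ
  have : 0 < γ - 1 := by linarith
  unfold energy
  positivity

lemma eq_of_energy_eq_zero {γ ρ u : ℝ} (hγ : 1 < γ) (hρ : 0 < ρ) (h : energy γ ρ u = 0) :
    ρ = 1 ∧ u = 0 := by
  have h1 := excess_nonneg hγ hρ
  have hγ1 : 0 < γ - 1 := by linarith
  have h2 : 0 ≤ ρ * u ^ 2 / 2 := by positivity
  have h3 : 0 ≤ excess γ ρ / (γ - 1) := by positivity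
  unfold energy at h
  have h4 : ρ * u ^ 2 / 2 = 0 := by linarith
  have h5 : excess γ ρ / (γ - 1) = 0 := by linarith
  constructor
  · by_contra hne
    have := excess_pos hγ hρ hne
    have : 0 < excess γ ρ / (γ - 1) := by positivity
    linarith
  · have : u ^ 2 = 0 := by
      rcases mul_eq_zero.1 (by linarith : ρ * u ^ 2 = 0) with h | h
      · exact absurd h hρ.ne'
      · exact h
    exact pow_eq_zero_iff (two_ne_zero) |>.1 this

lemma hasDerivAt_excess {γ ρ : ℝ} (hγ : 1 < γ) (hρ : 0 < ρ) :
    HasDerivAt (excess γ) (ρ ^ (γ - 1) - 1) ρ := by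
  have h := ((Real.hasDerivAt_rpow_const (p := γ) (Or.inl hρ.ne')).div_const γ).sub_const (1 / γ)
    |>.sub ((hasDerivAt_id ρ).sub_const 1)
  have hγ0 : γ ≠ 0 := by linarith
  refine h.congr_deriv ?_
  field_simp

/-- Near the rest state the sound speed is close to `1`: the squared pressure perturbation is
bounded by `(1 + o(1)) ρ` times twice the internal energy. -/
lemma eventually_sq_pressure_sub_le {γ c : ℝ} (hγ : 1 < γ) (hc : 1 < c) :
    ∀ᶠ ρ in 𝓝 (1 : ℝ),
      (pressure γ ρ - 1 / γ) ^ 2 ≤ c * (2 * ρ * (excess γ ρ / (γ - 1))) := by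
  have hγ0 : 0 < γ := by linarith
  have hγ1 : 0 < γ - 1 := by linarith
  have hpos : ∀ᶠ ρ in 𝓝[≠] (1 : ℝ), 0 < ρ :=
    nhdsWithin_le_nhds (lt_mem_nhds one_pos)
  have hne : ∀ᶠ ρ in 𝓝[≠] (1 : ℝ), ρ ≠ 1 := eventually_mem_nhdsWithin
  have hslope : ∀ p : ℝ, Tendsto (fun ρ : ℝ => (ρ ^ p - 1) / (ρ - 1)) (𝓝[≠] 1) (𝓝 p) := by
    intro p
    have h := Real.hasDerivAt_rpow_const (x := 1) (p := p) (Or.inl one_ne_zero)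
    rw [hasDerivAt_iff_tendsto_slope] at h
    simpa [slope_fun_def_field] using h
  have h1 : Tendsto (fun ρ : ℝ => (pressure γ ρ - 1 / γ) / (ρ - 1)) (𝓝[≠] 1) (𝓝 1) := by
    have := (hslope γ).div_const γ
    rw [div_self hγ0.ne'] at this
    refine this.congr fun ρ => ?_
    unfold pressure
    rw [← sub_div, div_right_comm]
  have h2 : Tendsto (fun ρ : ℝ => (excess γ ρ / (γ - 1)) / (ρ - 1) ^ 2) (𝓝[≠] 1)
      (𝓝 (1 / 2)) := by
    apply HasDerivAt.lhopital_zero_nhdsNE (f' := fun ρ => (ρ ^ (γ - 1) - 1) / (γ - 1))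
      (g' := fun ρ => 2 * (ρ - 1))
    · filter_upwards [hpos] with ρ hρ
      exact (hasDerivAt_excess hγ hρ).div_const _
    · refine Eventually.of_forall fun ρ => ?_
      exact (((hasDerivAt_id ρ).sub_const 1).fun_pow 2).congr_deriv (by simp)
    · filter_upwards [hne] with ρ hρ
      exact mul_ne_zero two_ne_zero (sub_ne_zero.2 hρ)
    · have := ((hasDerivAt_excess hγ one_pos).div_const (γ - 1)).continuousAt.tendsto
      simp only [excess_one, zero_div] at this
      exact this.mono_left nhdsWithin_le_nhds
    · have : Tendsto (fun ρ : ℝ => (ρ - 1) ^ 2) (𝓝 1) (𝓝 ((1 - 1) ^ 2)) :=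
        Continuous.tendsto (by fun_prop) 1
      simp only [sub_self, ne_eq, OfNat.ofNat_ne_zero, not_false_eq_true, zero_pow] at this
      exact this.mono_left nhdsWithin_le_nhds
    · have := ((hslope (γ - 1)).div_const (γ - 1)).div_const 2
      rw [div_self hγ1.ne'] at this
      refine this.congr fun ρ => ?_
      rw [div_div, div_div, div_div]
      congr 1
      ring
  have hρ1 : Tendsto (fun ρ : ℝ => ρ) (𝓝[≠] 1) (𝓝 1) := tendsto_id.mono_left nhdsWithin_le_nhds
  have h3 : Tendsto (fun ρ : ℝ => c * (2 * ρ * ((excess γ ρ / (γ - 1)) / (ρ - 1) ^ 2))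
      - ((pressure γ ρ - 1 / γ) / (ρ - 1)) ^ 2) (𝓝[≠] 1) (𝓝 (c * (2 * 1 * (1 / 2)) - 1 ^ 2)) :=
    (((hρ1.const_mul 2).mul h2).const_mul c).sub (h1.pow 2)
  have h4 : ∀ᶠ ρ in 𝓝[≠] (1 : ℝ),
      (pressure γ ρ - 1 / γ) ^ 2 ≤ c * (2 * ρ * (excess γ ρ / (γ - 1))) := by
    filter_upwards [h3 (lt_mem_nhds (by norm_num; exact hc : (0 : ℝ) < c * (2 * 1 * (1 / 2)) - 1 ^ 2)), hne]
      with ρ hρ hρ1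
    have hd : 0 < (ρ - 1) ^ 2 := by
      have := sub_ne_zero.2 hρ1
      positivity
    have h0 : 0 < c * (2 * ρ * ((excess γ ρ / (γ - 1)) / (ρ - 1) ^ 2))
      - ((pressure γ ρ - 1 / γ) / (ρ - 1)) ^ 2 := hρ
    have h5 := mul_pos h0 hd
    have hd' : ρ - 1 ≠ 0 := sub_ne_zero.2 hρ1
    have e : (c * (2 * ρ * ((excess γ ρ / (γ - 1)) / (ρ - 1) ^ 2))
      - ((pressure γ ρ - 1 / γ) / (ρ - 1)) ^ 2) * (ρ - 1) ^ 2 =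
      c * (2 * ρ * (excess γ ρ / (γ - 1))) - (pressure γ ρ - 1 / γ) ^ 2 := by
      generalize excess γ ρ = e
      generalize pressure γ ρ - 1 / γ = a
      field_simp
    rw [e] at h5
    linarith
  rw [eventually_nhdsWithin_iff] at h4
  filter_upwards [h4] with ρ hρ
  by_cases h : ρ = 1
  · subst h
    simp [pressure]
  · exact hρ h

/-- Near the rest state the energy flux is dominated by any multiple `σ > 1` of the energy. -/
lemma exists_abs_flux_le {γ σ : ℝ} (hγ : 1 < γ) (hσ : 1 < σ) :
    ∃ δ : ℝ, 0 < δ ∧ ∀ ρ u : ℝ, |ρ - 1| < δ → |u| < δ →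
      |u * (energy γ ρ u + (pressure γ ρ - 1 / γ))| ≤ σ * energy γ ρ u := by
  set c := (1 + σ) / 2 with hc
  have hc1 : 1 < c := by linarith
  obtain ⟨δ, hδ, h⟩ := Metric.eventually_nhds_iff.1
    (eventually_sq_pressure_sub_le hγ (one_lt_pow₀ hc1 two_ne_zero))
  refine ⟨min δ (min (1 / 2) ((σ - 1) / 2)), by
    have : 0 < (σ - 1) / 2 := by linarith
    positivity, ?_⟩
  intro ρ u hρ hu
  simp only [lt_min_iff] at hρ hu
  have hρ0 : 0 < ρ := by have := (abs_lt.1 hρ.2.1).1; linarith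
  have h1 := h (y := ρ) (by rw [Real.dist_eq]; exact hρ.1)
  have hE := energy_nonneg (u := u) hγ hρ0
  have h2 : |u * (pressure γ ρ - 1 / γ)| ≤ c * energy γ ρ u := by
    apply abs_le_of_sq_le_sq _ (by positivity)
    have h3 : u ^ 2 * (pressure γ ρ - 1 / γ) ^ 2 ≤
        u ^ 2 * (c ^ 2 * (2 * ρ * (excess γ ρ / (γ - 1)))) := by gcongr
    rw [mul_pow, mul_pow]
    refine h3.trans ?_
    unfold energy
    generalize excess γ ρ / (γ - 1) = e
    nlinarith [mul_nonneg (sq_nonneg c) (sq_nonneg (ρ * u ^ 2 / 2 - e))]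
  have h3 : |u * energy γ ρ u| ≤ (σ - 1) / 2 * energy γ ρ u := by
    rw [abs_mul, abs_of_nonneg hE]
    have := hu.2.2.le
    gcongr
  rw [mul_add]
  calc _ ≤ _ := abs_add_le _ _
    _ ≤ (σ - 1) / 2 * energy γ ρ u + c * energy γ ρ u := add_le_add h3 h2
    _ = _ := by rw [hc]; ring

/-! ### Hypergeometric series and a Legendre function -/

/-- Termwise differentiation of a power series with polynomially bounded coefficients inside the
unit interval. -/
lemma hasDerivAt_tsum_pow {c : ℕ → ℝ} {M : ℝ} {p : ℕ} (hc : ∀ j, |c j| ≤ M * (j + 1) ^ p) {z : ℝ}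
    (hz : |z| < 1) :
    (Summable fun j => c j * z ^ j) ∧
    HasDerivAt (fun z => ∑' j, c j * z ^ j) (∑' j : ℕ, (j + 1) * c (j + 1) * z ^ j) z := by
  obtain ⟨r, hzr, hr1⟩ := exists_between hz
  have hr0 : 0 ≤ r := (abs_nonneg z).trans hzr.le
  have hM : 0 ≤ M := by simpa using (abs_nonneg _).trans (hc 0)
  have hpow : ∀ p : ℕ, Summable fun j : ℕ => M * ((j : ℝ) + 1) ^ p * r ^ j := by
    intro p
    have h := summable_pow_mul_geometric_of_norm_lt_one p (r := r)
      (by rwa [Real.norm_eq_abs, abs_of_nonneg hr0])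
    have h2 : Summable fun j : ℕ => M * 2 ^ p * ((j : ℝ) ^ p * r ^ j) + M * r ^ j :=
      (h.mul_left _).add ((summable_geometric_of_lt_one hr0 hr1).mul_left _)
    refine Summable.of_nonneg_of_le (fun j => by positivity) (fun j => ?_) h2
    rcases Nat.eq_zero_or_pos j with rfl | hj
    · simp
      positivity
    · have hj' : (1 : ℝ) ≤ j := by exact_mod_cast hj
      have : ((j : ℝ) + 1) ^ p ≤ (2 * j) ^ p := pow_le_pow_left₀ (by positivity) (by linarith) p
      rw [mul_pow] at this
      have h3 : 0 ≤ M * r ^ j := by positivity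
      calc M * ((j : ℝ) + 1) ^ p * r ^ j ≤ M * (2 ^ p * j ^ p) * r ^ j := by gcongr
        _ = M * 2 ^ p * ((j : ℝ) ^ p * r ^ j) := by ring
        _ ≤ _ := by linarith
  have hs : ∀ y ∈ Ioo (-r) r, Summable fun j => c j * y ^ j := by
    intro y hy
    refine Summable.of_norm_bounded (hpow p) fun j => ?_
    rw [norm_mul, norm_pow, Real.norm_eq_abs, Real.norm_eq_abs]
    have : |y| ≤ r := (abs_lt.2 hy).le
    gcongr
    exact hc j
  have hzI : z ∈ Ioo (-r) r := abs_lt.1 hzr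
  refine ⟨hs z hzI, ?_⟩
  have hu : Summable fun j : ℕ => (j : ℝ) * (M * (j + 1) ^ p) * r ^ (j - 1) := by
    rw [← summable_nat_add_iff 1]
    have h := (hpow (p + 1)).mul_left (2 ^ p)
    refine Summable.of_nonneg_of_le (fun j => by positivity) (fun j => ?_) h
    push_cast
    have : ((j : ℝ) + 1 + 1) ^ p ≤ (2 * (j + 1)) ^ p :=
      pow_le_pow_left₀ (by positivity) (by linarith [(Nat.cast_nonneg j : (0 : ℝ) ≤ j)]) p
    rw [mul_pow] at this
    calc ((j : ℝ) + 1) * (M * (j + 1 + 1) ^ p) * r ^ j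
        ≤ ((j : ℝ) + 1) * (M * (2 ^ p * (j + 1) ^ p)) * r ^ j := by gcongr
      _ = _ := by ring
  have hd := hasDerivAt_tsum_of_isPreconnected (g := fun j y => c j * y ^ j)
    (g' := fun j y => c j * (j * y ^ (j - 1))) hu isOpen_Ioo isPreconnected_Ioo
    (fun j y _ => (hasDerivAt_pow j y).const_mul _) (fun j y hy => ?_) hzI (hs z hzI) hzI
  · refine hd.congr_deriv ?_
    have hsum : Summable fun j : ℕ => c j * (j * z ^ (j - 1)) := by
      refine Summable.of_norm_bounded hu fun j => ?_
      rw [norm_mul, norm_mul, norm_pow, Real.norm_eq_abs, Real.norm_eq_abs, Real.norm_eq_abs,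
        Nat.abs_cast]
      have := hc j
      calc |c j| * (j * |z| ^ (j - 1)) ≤ (M * (j + 1) ^ p) * (j * r ^ (j - 1)) := by gcongr
        _ = _ := by ring
    rw [hsum.tsum_eq_zero_add]
    simp only [CharP.cast_eq_zero, zero_mul, mul_zero, zero_add]
    refine tsum_congr fun j => ?_
    push_cast
    ring
  · rw [norm_mul, norm_mul, norm_pow, Real.norm_eq_abs, Real.norm_eq_abs, Real.norm_eq_abs,
        Nat.abs_cast]
    have h1 := hc j
    have h2 : |y| ≤ r := (abs_lt.2 hy).le
    calc |c j| * (j * |y| ^ (j - 1)) ≤ (M * (j + 1) ^ p) * (j * r ^ (j - 1)) := by gcongr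
      _ = _ := by ring

/-- Multiplication of a power series by the variable. -/
lemma hasSum_mul_pow_of_shift {b : ℕ → ℝ} {z S : ℝ} (hb : b 0 = 0)
    (h : HasSum (fun j => b (j + 1) * z ^ j) S) : HasSum (fun j => b j * z ^ j) (z * S) := by
  have h1 : HasSum (fun j => b (j + 1) * z ^ (j + 1)) (z * S) := by
    refine (h.mul_left z).congr_fun ?_
    intro j
    ring
  have := (hasSum_nat_add_iff (f := fun j => b j * z ^ j) 1).1 h1
  simpa [hb] using this

/-- Coefficients of the hypergeometric series `₂F₁(κ, κ; 1; z)`. -/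
noncomputable def hypCoeff (κ : ℝ) (j : ℕ) : ℝ :=
  ∏ i ∈ Finset.range j, ((κ + i) / (i + 1)) ^ 2

lemma hypCoeff_succ (κ : ℝ) (j : ℕ) :
    ((j : ℝ) + 1) ^ 2 * hypCoeff κ (j + 1) = (κ + j) ^ 2 * hypCoeff κ j := by
  rw [hypCoeff, Finset.prod_range_succ, ← hypCoeff]
  field_simp

lemma hypCoeff_nonneg (κ : ℝ) (j : ℕ) : 0 ≤ hypCoeff κ j :=
  Finset.prod_nonneg fun _ _ => sq_nonneg _

lemma hypCoeff_le_one {κ : ℝ} (h0 : 0 ≤ κ) (h1 : κ ≤ 1) (j : ℕ) : hypCoeff κ j ≤ 1 := by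
  refine Finset.prod_le_one (fun _ _ => sq_nonneg _) fun i _ => ?_
  refine pow_le_one₀ (by positivity) ?_
  rw [div_le_one (by positivity)]
  linarith

/-- The hypergeometric function `F = ₂F₁(κ, κ; 1; ·)` on `(-1, 1)`, with its first two derivatives,
its differential equation, and the positivity of its coefficients. -/
lemma exists_hypergeometric {κ : ℝ} (h0 : 0 ≤ κ) (h1 : κ ≤ 1) :
    ∃ F F' F'' : ℝ → ℝ, (∀ z, |z| < 1 → HasDerivAt F (F' z) z) ∧
      (∀ z, |z| < 1 → HasDerivAt F' (F'' z) z) ∧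
      (∀ z, |z| < 1 →
        z * (1 - z) * F'' z + (1 - (2 * κ + 1) * z) * F' z - κ ^ 2 * F z = 0) ∧
      (∀ z, 0 ≤ z → z < 1 → 1 ≤ F z ∧ 0 ≤ F' z) := by
  set c := hypCoeff κ with hc
  have hb : ∀ j, |c j| ≤ 1 * ((j : ℝ) + 1) ^ 0 := fun j => by
    simpa [hc, abs_of_nonneg (hypCoeff_nonneg κ j)] using hypCoeff_le_one h0 h1 j
  have hb1 : ∀ j : ℕ, |((j : ℝ) + 1) * c (j + 1)| ≤ 1 * ((j : ℝ) + 1) ^ 1 := fun j => by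
    rw [abs_mul, abs_of_nonneg (hypCoeff_nonneg κ _), abs_of_nonneg (by positivity)]
    have := hypCoeff_le_one h0 h1 (j + 1)
    have h2 : (0 : ℝ) ≤ (j : ℝ) + 1 := by positivity
    nlinarith
  have hb2 : ∀ j : ℕ, |((j : ℝ) + 1) * (((j + 1 : ℕ) : ℝ) + 1) * c (j + 1 + 1)|
      ≤ 2 * ((j : ℝ) + 1) ^ 2 := fun j => by
    rw [abs_mul, abs_of_nonneg (hypCoeff_nonneg κ _), abs_of_nonneg (by positivity)]
    have := hypCoeff_le_one h0 h1 (j + 1 + 1)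
    have h2 : (0 : ℝ) ≤ j := by positivity
    push_cast
    calc ((j : ℝ) + 1) * (j + 1 + 1) * hypCoeff κ (j + 1 + 1) ≤ ((j : ℝ) + 1) * (j + 1 + 1) * 1 := by
          gcongr
      _ ≤ _ := by nlinarith
  refine ⟨fun z => ∑' j, c j * z ^ j, fun z => ∑' j : ℕ, (j + 1) * c (j + 1) * z ^ j,
    fun z => ∑' j : ℕ, (j + 1) * (((j + 1 : ℕ) + 1) * c (j + 1 + 1)) * z ^ j, ?_, ?_, ?_, ?_⟩
  · exact fun z hz => (hasDerivAt_tsum_pow hb hz).2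
  · exact fun z hz => (hasDerivAt_tsum_pow hb1 hz).2
  · intro z hz
    have s0 := (hasDerivAt_tsum_pow hb hz).1.hasSum
    have s1 := (hasDerivAt_tsum_pow hb1 hz).1.hasSum
    have s2 := (hasDerivAt_tsum_pow hb2 hz).1.hasSum
    dsimp only
    have e2 : (∑' j : ℕ, ((j : ℝ) + 1) * (((j + 1 : ℕ) + 1) * c (j + 1 + 1)) * z ^ j) =
        ∑' j : ℕ, ((j : ℝ) + 1) * (((j + 1 : ℕ) : ℝ) + 1) * c (j + 1 + 1) * z ^ j :=
      tsum_congr fun j => by ring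
    rw [e2]
    generalize (∑' j, c j * z ^ j) = S0 at *
    generalize (∑' j : ℕ, ((j : ℝ) + 1) * c (j + 1) * z ^ j) = S1 at *
    generalize (∑' j : ℕ, ((j : ℝ) + 1) * (((j + 1 : ℕ) : ℝ) + 1) * c (j + 1 + 1) * z ^ j) = S2 at *
    have t1 : HasSum (fun j : ℕ => (j : ℝ) * c j * z ^ j) (z * S1) :=
      hasSum_mul_pow_of_shift (b := fun j => (j : ℝ) * c j) (by simp) (by simpa using s1)
    have t2 : HasSum (fun j : ℕ => (j : ℝ) * (j + 1) * c (j + 1) * z ^ j) (z * S2) :=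
      hasSum_mul_pow_of_shift (b := fun j => (j : ℝ) * (j + 1) * c (j + 1)) (by simp)
        (by simpa using s2)
    have t3 : HasSum (fun j : ℕ => (j : ℝ) * (j - 1) * c j * z ^ j) (z * (z * S2)) :=
      hasSum_mul_pow_of_shift (b := fun j => (j : ℝ) * (j - 1) * c j) (by simp)
        (by
          refine t2.congr_fun ?_
          intro j
          push_cast
          ring)
    have tot := (((t2.sub t3).add s1).sub (t1.mul_left (2 * κ + 1))).sub (s0.mul_left (κ ^ 2))
    have tot0 : HasSum (fun _ : ℕ => (0 : ℝ)) (z * S2 - z * (z * S2) + S1 - (2 * κ + 1) * (z * S1)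
        - κ ^ 2 * S0) := by
      refine tot.congr_fun ?_
      intro j
      have := hypCoeff_succ κ j
      rw [← hc] at this
      linear_combination (-z ^ j) * this
    have := tot0.unique hasSum_zero
    linear_combination this
  · intro z hz0 hz1
    have hz : |z| < 1 := by rwa [abs_of_nonneg hz0]
    have s0 := (hasDerivAt_tsum_pow hb hz).1
    constructor
    · have := s0.le_tsum 0 (fun j _ => mul_nonneg (hypCoeff_nonneg κ j) (pow_nonneg hz0 j))
      simpa [hc, hypCoeff] using this
    · exact tsum_nonneg fun j => mul_nonneg (mul_nonneg (by positivity) (hypCoeff_nonneg κ _))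
        (pow_nonneg hz0 j)

/-- A Legendre function: a solution `f` of `((ξ² - 1) f')' + κ (1 - κ) f = 0` which is regular at
`ξ = 1`, and positive for `ξ ≥ 1`. The inequality `0 ≤ κ f + ξ f'` says that
`ξ ^ κ f` is nondecreasing. -/
lemma exists_legendre {κ : ℝ} (h0 : 0 ≤ κ) (h1 : κ ≤ 1) :
    ∃ f f' : ℝ → ℝ, (∀ ξ, 0 < ξ → HasDerivAt f (f' ξ) ξ) ∧
      (∀ ξ, 0 < ξ → HasDerivAt (fun ξ => (ξ ^ 2 - 1) * f' ξ) (-(κ * (1 - κ)) * f ξ) ξ) ∧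
      (∀ ξ, 1 ≤ ξ → 0 < f ξ ∧ 0 ≤ κ * f ξ + ξ * f' ξ) ∧ 1 / 2 ≤ f 1 := by
  obtain ⟨F, F', F'', hF, hF', hode, hpos⟩ := exists_hypergeometric h0 h1
  -- `f = (ξ + 1) ^ (-κ) ₂F₁(κ, κ; 1; (ξ - 1) / (ξ + 1))`, since in this variable the whole
  -- half-line `ξ ≥ 1` lies in the disc of convergence
  let Z : ℝ → ℝ := fun ξ => (ξ - 1) / (ξ + 1)
  have hZ1 : ∀ ξ, 0 < ξ → |Z ξ| < 1 := by
    intro ξ hξ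
    rw [abs_div, abs_of_pos (by linarith : 0 < ξ + 1), div_lt_one (by linarith), abs_lt]
    constructor <;> linarith
  have hZ' : ∀ ξ, 0 < ξ → HasDerivAt Z (2 / (ξ + 1) ^ 2) ξ := by
    intro ξ hξ
    have hne : ξ + 1 ≠ 0 := by linarith
    refine (((hasDerivAt_id ξ).sub_const 1).fun_div ((hasDerivAt_id ξ).add_const 1) hne).congr_deriv ?_
    simp only [id]
    congr 1
    ring
  have hP : ∀ ξ : ℝ, 0 < ξ → HasDerivAt (fun ξ : ℝ => (ξ + 1) ^ (-κ))
      (-κ * (ξ + 1) ^ (-κ) / (ξ + 1)) ξ := by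
    intro ξ hξ
    have hne : 0 < ξ + 1 := by linarith
    refine (((hasDerivAt_id ξ).add_const 1).rpow_const (Or.inl hne.ne')).congr_deriv ?_
    simp only [id]
    rw [Real.rpow_sub_one hne.ne']
    ring
  let f' : ℝ → ℝ := fun ξ => (ξ + 1) ^ (-κ) *
    (-κ * F (Z ξ) / (ξ + 1) + 2 * F' (Z ξ) / (ξ + 1) ^ 2)
  refine ⟨fun ξ => (ξ + 1) ^ (-κ) * F (Z ξ), f', ?_, ?_, ?_, ?_⟩
  · intro ξ hξ
    have hne : 0 < ξ + 1 := by linarith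
    refine ((hP ξ hξ).fun_mul ((hF _ (hZ1 ξ hξ)).comp ξ (hZ' ξ hξ))).congr_deriv ?_
    simp only [Function.comp, f']
    field_simp
  · intro ξ hξ
    have hne : 0 < ξ + 1 := by linarith
    have hd : HasDerivAt (fun ξ : ℝ => (ξ + 1) ^ (-κ) *
        (-κ * ((ξ - 1) * F (Z ξ)) + 2 * (Z ξ * F' (Z ξ))))
        (-(κ * (1 - κ)) * ((ξ + 1) ^ (-κ) * F (Z ξ))) ξ := by
      refine ((hP ξ hξ).fun_mul (((((hasDerivAt_id ξ).sub_const 1).fun_mul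
        ((hF _ (hZ1 ξ hξ)).comp ξ (hZ' ξ hξ))).const_mul (-κ)).fun_add
        (((hZ' ξ hξ).fun_mul ((hF' _ (hZ1 ξ hξ)).comp ξ (hZ' ξ hξ))).const_mul 2))).congr_deriv ?_
      simp only [Function.comp, id]
      have ho := hode (Z ξ) (hZ1 ξ hξ)
      generalize F (Z ξ) = a at *
      generalize F' (Z ξ) = b at *
      generalize F'' (Z ξ) = d at *
      have hz : Z ξ = (ξ - 1) / (ξ + 1) := rfl
      rw [hz] at *
      generalize (ξ + 1) ^ (-κ) = P
      have ho2 : 4 * (ξ - 1) / (ξ + 1) ^ 3 * d = 2 / (ξ + 1) *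
          (κ ^ 2 * a - (1 - (2 * κ + 1) * ((ξ - 1) / (ξ + 1))) * b) := by
        have e : κ ^ 2 * a - (1 - (2 * κ + 1) * ((ξ - 1) / (ξ + 1))) * b =
          (ξ - 1) / (ξ + 1) * (1 - (ξ - 1) / (ξ + 1)) * d := by linarith
        rw [e]
        field_simp
        ring
      have e3 : -κ * P / (ξ + 1) * (-κ * ((ξ - 1) * a) + 2 * ((ξ - 1) / (ξ + 1) * b)) +
          P * (-κ * (1 * a + (ξ - 1) * (b * (2 / (ξ + 1) ^ 2))) +
          2 * (2 / (ξ + 1) ^ 2 * b + (ξ - 1) / (ξ + 1) * (d * (2 / (ξ + 1) ^ 2)))) =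
          -κ * P / (ξ + 1) * (-κ * ((ξ - 1) * a) + 2 * ((ξ - 1) / (ξ + 1) * b)) +
          P * (-κ * (1 * a + (ξ - 1) * (b * (2 / (ξ + 1) ^ 2))) +
          2 * (2 / (ξ + 1) ^ 2 * b) + 4 * (ξ - 1) / (ξ + 1) ^ 3 * d) := by
        field_simp
        ring
      rw [e3, ho2]
      field_simp
      ring
    refine hd.congr_of_eventuallyEq ?_
    filter_upwards [lt_mem_nhds hξ] with x hx
    have hx1 : 0 < x + 1 := by linarith
    simp only [f']
    have : Z x * F' (Z x) = (x - 1) / (x + 1) * F' (Z x) := rfl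
    rw [this]
    field_simp
    ring
  · intro ξ hξ
    have hne : 0 < ξ + 1 := by linarith
    have hz0 : 0 ≤ Z ξ := div_nonneg (by linarith) hne.le
    obtain ⟨hF1, hF1'⟩ := hpos (Z ξ) hz0 (lt_of_le_of_lt (le_abs_self _) (hZ1 ξ (by linarith)))
    have hP0 : 0 < (ξ + 1) ^ (-κ) := by positivity
    refine ⟨by positivity, ?_⟩
    have e : κ * ((ξ + 1) ^ (-κ) * F (Z ξ)) + ξ * f' ξ = (ξ + 1) ^ (-κ) *
        (κ * F (Z ξ) / (ξ + 1) + 2 * ξ * F' (Z ξ) / (ξ + 1) ^ 2) := by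
      simp only [f']
      field_simp
      ring
    rw [e]
    have : 0 ≤ F (Z ξ) := by linarith
    have : 0 ≤ ξ := by linarith
    positivity
  · have hF1 := (hpos 0 le_rfl one_pos).1
    have : Z 1 = 0 := by simp [Z]
    simp only [this]
    have h2 : (1 / 2 : ℝ) ≤ (1 + 1) ^ (-κ) := by
      have : ((1 : ℝ) + 1) ^ (-1 : ℝ) ≤ (1 + 1) ^ (-κ) :=
        Real.rpow_le_rpow_of_exponent_le (by norm_num) (by linarith)
      rw [Real.rpow_neg_one] at this
      norm_num at this ⊢
      exact this
    have h3 : (0 : ℝ) < (1 + 1) ^ (-κ) := by positivity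
    nlinarith

/-! ### Profiles of homogeneous test functions -/

lemma eq_zero_of_hasDerivAt_zero {E : ℝ → ℝ} (hc : ContinuousOn E (Ici 1)) (h1 : E 1 = 0)
    (hd : ∀ ξ, 1 < ξ → HasDerivAt E 0 ξ) {ξ : ℝ} (hξ : 1 ≤ ξ) : E ξ = 0 := by
  have hdiff : DifferentiableOn ℝ E (interior (Ici (1 : ℝ))) := by
    rw [interior_Ici]
    exact fun x hx => (hd x hx).differentiableAt.differentiableWithinAt
  have hm : MonotoneOn E (Ici 1) := monotoneOn_of_deriv_nonneg (convex_Ici 1) hc hdiff (by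
    rw [interior_Ici]
    exact fun x hx => (hd x hx).deriv.ge)
  have ha : AntitoneOn E (Ici 1) := antitoneOn_of_deriv_nonpos (convex_Ici 1) hc hdiff (by
    rw [interior_Ici]
    exact fun x hx => (hd x hx).deriv.le)
  have := hm self_mem_Ici hξ hξ
  have := ha self_mem_Ici hξ hξ
  linarith

/-- The primitive, vanishing on `(-∞, 1]`, of a nonnegative monotone function with that property. -/
lemma primitive_properties {g : ℝ → ℝ} (hg : Continuous g) (h0 : ∀ ξ ≤ 1, g ξ = 0)
    (hm : Monotone g) :
    (∀ ξ, HasDerivAt (fun ξ => ∫ s in (1 : ℝ)..ξ, g s) (g ξ) ξ) ∧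
    (∀ ξ ≤ 1, ∫ s in (1 : ℝ)..ξ, g s = 0) ∧ (Monotone fun ξ => ∫ s in (1 : ℝ)..ξ, g s) ∧
    (∀ ξ, 1 ≤ ξ → ∫ s in (1 : ℝ)..ξ, g s ≤ (ξ - 1) * g ξ) := by
  have hd : ∀ ξ, HasDerivAt (fun ξ => ∫ s in (1 : ℝ)..ξ, g s) (g ξ) ξ := fun ξ =>
    intervalIntegral.integral_hasDerivAt_right (hg.intervalIntegrable _ _)
      hg.aestronglyMeasurable.stronglyMeasurableAtFilter hg.continuousAt
  have hnn : ∀ ξ, 0 ≤ g ξ := by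
    intro ξ
    rcases le_total ξ 1 with h | h
    · exact (h0 ξ h).ge
    · rw [← h0 1 le_rfl]; exact hm h
  refine ⟨hd, ?_, ?_, ?_⟩
  · intro ξ hξ
    rw [intervalIntegral.integral_congr (g := fun _ => 0)]
    · simp
    · intro s hs
      rw [uIcc_of_ge hξ] at hs
      exact h0 s hs.2
  · refine monotone_of_deriv_nonneg (fun ξ => (hd ξ).differentiableAt) fun ξ => ?_
    rw [(hd ξ).deriv]
    exact hnn ξ
  · intro ξ hξ
    have : ∫ s in (1 : ℝ)..ξ, g s ≤ ∫ _ in (1 : ℝ)..ξ, g ξ :=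
      intervalIntegral.integral_mono_on hξ (hg.intervalIntegrable _ _) (by simp)
        fun s hs => hm hs.2
    simpa using this

/-- The profile of a homogeneous test function. `Φ 4` is the four-fold primitive, starting at
`ξ = 1` and extended by zero to `ξ ≤ 1`, of the Legendre function `Φ 0`; the functions `Φ 3`,
`Φ 2`, `Φ 1`, `Φ 0` are its successive derivatives. The function
`k (x, τ) = τ ^ (4 - κ) Φ 4 (x / τ)` solves `k_ττ + (2 κ / τ) k_τ = k_xx`, by `ode`, and vanishes
for `x ≤ τ`. The inequality `half_le` is the lower bound for the weight of the initial density;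
`L` and `C` only enter in the growth bound `le_sq` near `ξ = 1`. -/
structure IsProfile (κ L C : ℝ) (Φ : ℕ → ℝ → ℝ) : Prop where
  hasDerivAt : ∀ i, 1 ≤ i → ∀ ξ, HasDerivAt (Φ (i + 1)) (Φ i ξ) ξ
  continuous : ∀ i, 1 ≤ i → Continuous (Φ i)
  hasDerivAt_one : ∀ ξ, 1 < ξ → HasDerivAt (Φ 1) (Φ 0 ξ) ξ
  continuousOn_zero : ContinuousOn (Φ 0) (Ici 1)
  eq_zero : ∀ i, 1 ≤ i → ∀ ξ ≤ 1, Φ i ξ = 0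
  nonneg : ∀ i, 1 ≤ i → ∀ ξ, 0 ≤ Φ i ξ
  le_mul : ∀ i, 1 ≤ i → ∀ ξ, 1 ≤ ξ → Φ (i + 1) ξ ≤ (ξ - 1) * Φ i ξ
  le_sq : ∀ ξ ∈ Icc 1 (1 + L), Φ 2 ξ ≤ C * (ξ - 1) ^ 2
  half_le : ∀ ξ, 1 ≤ ξ → 1 / 2 ≤ ξ * Φ 0 ξ - (1 - κ) * Φ 1 ξ
  ode : ∀ ξ, (ξ ^ 2 - 1) * Φ 2 ξ - 6 * ξ * Φ 3 ξ + (4 - κ) * (3 + κ) * Φ 4 ξ = 0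

lemma exists_isProfile {κ : ℝ} (h0 : 0 ≤ κ) (h1 : κ ≤ 1) (L : ℝ) :
    ∃ (C : ℝ) (Φ : ℕ → ℝ → ℝ), 0 < C ∧ IsProfile κ L C Φ := by
  obtain ⟨f, f', hf, hf', hpos, hf1⟩ := exists_legendre h0 h1
  have hfc : ContinuousOn f (Ioi 0) := fun ξ hξ => (hf ξ hξ).continuousAt.continuousWithinAt
  have hIci : Ici (1 : ℝ) ⊆ Ioi 0 := fun x hx => mem_Ioi.2 (lt_of_lt_of_le one_pos (mem_Ici.1 hx))
  -- `f` is made constant below `1` in order to have continuous integrands on the whole line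
  have hfm : Continuous fun ξ => f (max ξ 1) :=
    hfc.comp_continuous (by fun_prop) fun ξ => hIci (mem_Ici.2 (le_max_right _ _))
  let G : ℝ → ℝ := fun ξ => ∫ s in (1 : ℝ)..ξ, f (max s 1)
  have hG : ∀ ξ, HasDerivAt G (f (max ξ 1)) ξ := fun ξ =>
    intervalIntegral.integral_hasDerivAt_right (hfm.intervalIntegrable _ _)
      hfm.aestronglyMeasurable.stronglyMeasurableAtFilter hfm.continuousAt
  have hGm : Monotone G := monotone_of_deriv_nonneg (fun ξ => (hG ξ).differentiableAt) fun ξ => by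
    rw [(hG ξ).deriv]
    exact (hpos _ (le_max_right _ _)).1.le
  have hG1 : G 1 = 0 := by simp [G]
  let Φ : ℕ → ℝ → ℝ := fun i => Nat.recOn i f fun j P =>
    if j = 0 then fun ξ => G (max ξ 1) else fun ξ => ∫ s in (1 : ℝ)..ξ, P s
  have hΦ0 : Φ 0 = f := rfl
  have hΦ1 : Φ 1 = fun ξ => G (max ξ 1) := rfl
  have hΦs : ∀ i, 1 ≤ i → Φ (i + 1) = fun ξ => ∫ s in (1 : ℝ)..ξ, Φ i s := by
    intro i hi
    have : i ≠ 0 := by omega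
    simp only [Φ]
    rw [if_neg this]
  have hGc : Continuous G := continuous_iff_continuousAt.2 fun ξ => (hG ξ).continuousAt
  have hbase : ∀ i, 1 ≤ i → Continuous (Φ i) ∧ (∀ ξ ≤ 1, Φ i ξ = 0) ∧ Monotone (Φ i) := by
    intro i hi
    induction i, hi using Nat.le_induction with
    | base =>
      refine ⟨?_, ?_, ?_⟩
      · rw [hΦ1]; fun_prop
      · intro ξ hξ
        rw [hΦ1]
        simp only [max_eq_right hξ, hG1]
      · rw [hΦ1]
        exact fun a b hab => hGm (max_le_max hab le_rfl)
    | succ i hi ih =>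
      obtain ⟨p1, p2, p3, -⟩ := primitive_properties ih.1 ih.2.1 ih.2.2
      rw [hΦs i hi]
      exact ⟨continuous_iff_continuousAt.2 fun ξ => (p1 ξ).continuousAt, p2, p3⟩
  have hder : ∀ i, 1 ≤ i → ∀ ξ, HasDerivAt (Φ (i + 1)) (Φ i ξ) ξ := by
    intro i hi ξ
    obtain ⟨b1, b2, b3⟩ := hbase i hi
    rw [hΦs i hi]
    exact (primitive_properties b1 b2 b3).1 ξ
  have hder1 : ∀ ξ, 1 < ξ → HasDerivAt (Φ 1) (Φ 0 ξ) ξ := by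
    intro ξ hξ
    have := hG ξ
    rw [max_eq_left hξ.le] at this
    refine this.congr_of_eventuallyEq ?_
    filter_upwards [lt_mem_nhds hξ] with x hx
    rw [hΦ1]
    simp only [max_eq_left (le_of_lt hx)]
  have hnn : ∀ i, 1 ≤ i → ∀ ξ, 0 ≤ Φ i ξ := by
    intro i hi ξ
    obtain ⟨-, b2, b3⟩ := hbase i hi
    rcases le_total ξ 1 with h | h
    · exact (b2 ξ h).ge
    · rw [← b2 1 le_rfl]; exact b3 h
  have hle : ∀ i, 1 ≤ i → ∀ ξ, 1 ≤ ξ → Φ (i + 1) ξ ≤ (ξ - 1) * Φ i ξ := by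
    intro i hi ξ hξ
    obtain ⟨b1, b2, b3⟩ := hbase i hi
    rw [hΦs i hi]
    exact (primitive_properties b1 b2 b3).2.2.2 ξ hξ
  have hΦ01 : ContinuousOn (Φ 0) (Ici 1) := hfc.mono hIci
  have hz1 : ∀ i, 1 ≤ i → Φ i 1 = 0 := fun i hi => (hbase i hi).2.1 1 le_rfl
  have hcI : ∀ i, 1 ≤ i → ContinuousOn (Φ i) (Ici 1) := fun i hi => (hbase i hi).1.continuousOn
  obtain ⟨C, hC⟩ := isCompact_Icc.exists_bound_of_continuousOn
    (hΦ01.mono (Icc_subset_Ici_self : Icc 1 (1 + L) ⊆ Ici 1))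
  -- successive primitives of Legendre's equation
  have hE1 : ∀ ξ, 1 ≤ ξ → (ξ ^ 2 - 1) * f' ξ + κ * (1 - κ) * Φ 1 ξ = 0 := by
    intro ξ hξ
    refine eq_zero_of_hasDerivAt_zero (E := fun ξ => (ξ ^ 2 - 1) * f' ξ + κ * (1 - κ) * Φ 1 ξ)
      ?_ ?_ ?_ hξ
    · refine ContinuousOn.add ?_ ((hcI 1 le_rfl).const_mul _)
      exact fun x hx => (hf' x (hIci hx)).continuousAt.continuousWithinAt
    · simp [hz1 1 le_rfl]
    · intro x hx
      refine ((hf' x (hIci (le_of_lt hx))).fun_add ((hder1 x hx).const_mul _)).congr_deriv ?_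
      rw [hΦ0]
      ring
  have hsq : ∀ x : ℝ, HasDerivAt (fun ξ : ℝ => ξ ^ 2 - 1) (2 * x) x := fun x => by
    simpa using (hasDerivAt_pow 2 x).sub_const 1
  have hE2 : ∀ ξ, 1 ≤ ξ →
      (ξ ^ 2 - 1) * Φ 0 ξ - 2 * ξ * Φ 1 ξ + (2 - κ) * (1 + κ) * Φ 2 ξ = 0 := by
    intro ξ hξ
    refine eq_zero_of_hasDerivAt_zero
      (E := fun ξ => (ξ ^ 2 - 1) * Φ 0 ξ - 2 * ξ * Φ 1 ξ + (2 - κ) * (1 + κ) * Φ 2 ξ) ?_ ?_ ?_ hξ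
    · have := hcI 1 le_rfl
      have := hcI 2 (by norm_num)
      fun_prop
    · simp [hz1 1 le_rfl, hz1 2 (by norm_num)]
    · intro x hx
      refine ((((hsq x).fun_mul (hf x (hIci (le_of_lt hx)))).fun_sub
        (((hasDerivAt_id x).const_mul 2).fun_mul (hder1 x hx))).fun_add
        ((hder 1 le_rfl x).const_mul _)).congr_deriv ?_
      have := hE1 x (le_of_lt hx)
      simp only [id, hΦ0] at *
      linear_combination this
  have hE3 : ∀ ξ, 1 ≤ ξ →
      (ξ ^ 2 - 1) * Φ 1 ξ - 4 * ξ * Φ 2 ξ + (3 - κ) * (2 + κ) * Φ 3 ξ = 0 := by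
    intro ξ hξ
    refine eq_zero_of_hasDerivAt_zero
      (E := fun ξ => (ξ ^ 2 - 1) * Φ 1 ξ - 4 * ξ * Φ 2 ξ + (3 - κ) * (2 + κ) * Φ 3 ξ) ?_ ?_ ?_ hξ
    · have := hcI 1 le_rfl
      have := hcI 2 (by norm_num)
      have := hcI 3 (by norm_num)
      fun_prop
    · simp [hz1 2 (by norm_num), hz1 3 (by norm_num)]
    · intro x hx
      refine ((((hsq x).fun_mul (hder1 x hx)).fun_sub
        (((hasDerivAt_id x).const_mul 4).fun_mul (hder 1 le_rfl x))).fun_add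
        ((hder 2 (by norm_num) x).const_mul _)).congr_deriv ?_
      have := hE2 x (le_of_lt hx)
      simp only [id] at *
      linear_combination this
  have hE4 : ∀ ξ, 1 ≤ ξ →
      (ξ ^ 2 - 1) * Φ 2 ξ - 6 * ξ * Φ 3 ξ + (4 - κ) * (3 + κ) * Φ 4 ξ = 0 := by
    intro ξ hξ
    refine eq_zero_of_hasDerivAt_zero
      (E := fun ξ => (ξ ^ 2 - 1) * Φ 2 ξ - 6 * ξ * Φ 3 ξ + (4 - κ) * (3 + κ) * Φ 4 ξ) ?_ ?_ ?_ hξ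
    · have := hcI 2 (by norm_num)
      have := hcI 3 (by norm_num)
      have := hcI 4 (by norm_num)
      fun_prop
    · simp [hz1 3 (by norm_num), hz1 4 (by norm_num)]
    · intro x hx
      refine ((((hsq x).fun_mul (hder 1 le_rfl x)).fun_sub
        (((hasDerivAt_id x).const_mul 6).fun_mul (hder 2 (by norm_num) x))).fun_add
        ((hder 3 (by norm_num) x).const_mul _)).congr_deriv ?_
      have := hE3 x (le_of_lt hx)
      simp only [id] at *
      linear_combination this
  refine ⟨max C 1, Φ, by positivity, ⟨hder, fun i hi => (hbase i hi).1, hder1, hΦ01,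
    fun i hi => (hbase i hi).2.1, hnn, hle, ?_, ?_, ?_⟩⟩
  · intro ξ hξ
    have hΦ1le : Φ 1 ξ ≤ max C 1 * (ξ - 1) := by
      rw [hΦ1]
      simp only [max_eq_left hξ.1, G]
      have : ∫ s in (1 : ℝ)..ξ, f (max s 1) ≤ ∫ _ in (1 : ℝ)..ξ, max C 1 := by
        refine intervalIntegral.integral_mono_on hξ.1 (hfm.intervalIntegrable _ _) (by simp) ?_
        intro s hs
        rw [max_eq_left hs.1]
        exact ((le_abs_self _).trans (hC s ⟨hs.1, hs.2.trans hξ.2⟩)).trans (le_max_left _ _)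
      refine this.trans (le_of_eq ?_)
      simp
      ring
    have h2 := hle 1 le_rfl ξ hξ.1
    have : 0 ≤ ξ - 1 := by linarith [hξ.1]
    calc Φ 2 ξ ≤ (ξ - 1) * Φ 1 ξ := h2
      _ ≤ (ξ - 1) * (max C 1 * (ξ - 1)) := by gcongr
      _ = _ := by ring
  · intro ξ hξ
    have hm : MonotoneOn (fun ξ => ξ * Φ 0 ξ - (1 - κ) * Φ 1 ξ) (Ici 1) := by
      have hd : ∀ x, 1 < x → HasDerivAt (fun ξ => ξ * Φ 0 ξ - (1 - κ) * Φ 1 ξ)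
          (κ * f x + x * f' x) x := by
        intro x hx
        refine (((hasDerivAt_id x).fun_mul (hf x (hIci (le_of_lt hx)))).fun_sub
          ((hder1 x hx).const_mul _)).congr_deriv ?_
        simp only [id, hΦ0]
        ring
      apply monotoneOn_of_deriv_nonneg (convex_Ici 1)
      · have := hcI 1 le_rfl
        fun_prop
      · rw [interior_Ici]
        exact fun x hx => (hd x hx).differentiableAt.differentiableWithinAt
      · rw [interior_Ici]
        intro x hx
        rw [(hd x hx).deriv]
        exact (hpos x (le_of_lt hx)).2
    have := hm self_mem_Ici hξ hξ
    simp only [hz1 1 le_rfl, hΦ0] at this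
    rw [hΦ0]
    linarith
  · intro ξ
    rcases le_total 1 ξ with h | h
    · exact hE4 ξ h
    · rw [(hbase 2 (by norm_num)).2.1 ξ h, (hbase 3 (by norm_num)).2.1 ξ h,
        (hbase 4 (by norm_num)).2.1 ξ h]
      ring

/-! ### Balance laws and finite speed of propagation -/

/-- The open space-time strip `ℝ × (0, T)`. -/
def openStrip (T : ℝ) : Set (ℝ × ℝ) := univ ×ˢ Ioo 0 T

/-- The closed space-time strip `ℝ × [0, T]`. -/
def closedStrip (T : ℝ) : Set (ℝ × ℝ) := univ ×ˢ Icc 0 T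

lemma isOpen_openStrip (T : ℝ) : IsOpen (openStrip T) := isOpen_univ.prod isOpen_Ioo

lemma openStrip_subset (T : ℝ) : openStrip T ⊆ closedStrip T :=
  prod_mono le_rfl Ioo_subset_Icc_self

lemma mem_openStrip {T x t : ℝ} (ht : t ∈ Ioo 0 T) : (x, t) ∈ openStrip T := ⟨mem_univ _, ht⟩

lemma mem_closedStrip {T x t : ℝ} (ht : t ∈ Icc 0 T) : (x, t) ∈ closedStrip T := ⟨mem_univ _, ht⟩

section Partial

variable {T : ℝ} {f : ℝ → ℝ → ℝ}

lemma hasDerivAt_time (hf : ContDiffOn ℝ 1 (fun z : ℝ × ℝ => f z.1 z.2) (openStrip T)) {x t : ℝ}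
    (ht : t ∈ Ioo 0 T) :
    HasDerivAt (fun s => f x s) (fderiv ℝ (fun z : ℝ × ℝ => f z.1 z.2) (x, t) (0, 1)) t := by
  have h := ((hf.contDiffAt ((isOpen_openStrip T).mem_nhds
    (mem_openStrip (x := x) ht))).differentiableAt one_ne_zero).hasFDerivAt
  have hc : HasDerivAt (fun s : ℝ => (x, s)) ((0 : ℝ), (1 : ℝ)) t :=
    (hasDerivAt_const t x).prodMk (hasDerivAt_id t)
  exact h.comp_hasDerivAt t hc

lemma hasDerivAt_space (hf : ContDiffOn ℝ 1 (fun z : ℝ × ℝ => f z.1 z.2) (openStrip T)) {x t : ℝ}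
    (ht : t ∈ Ioo 0 T) :
    HasDerivAt (fun y => f y t) (fderiv ℝ (fun z : ℝ × ℝ => f z.1 z.2) (x, t) (1, 0)) x := by
  have h := ((hf.contDiffAt ((isOpen_openStrip T).mem_nhds
    (mem_openStrip (x := x) ht))).differentiableAt one_ne_zero).hasFDerivAt
  have hc : HasDerivAt (fun y : ℝ => (y, t)) ((1 : ℝ), (0 : ℝ)) x :=
    (hasDerivAt_id x).prodMk (hasDerivAt_const x t)
  exact h.comp_hasDerivAt x hc

lemma continuousOn_fderiv_apply (hf : ContDiffOn ℝ 1 (fun z : ℝ × ℝ => f z.1 z.2) (openStrip T))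
    (v : ℝ × ℝ) :
    ContinuousOn (fun z => fderiv ℝ (fun z : ℝ × ℝ => f z.1 z.2) z v) (openStrip T) :=
  (hf.continuousOn_fderiv_of_isOpen (isOpen_openStrip T) le_rfl).clm_apply continuousOn_const

lemma continuous_slice {g : ℝ × ℝ → ℝ} {S : Set ℝ} (hg : ContinuousOn g (univ ×ˢ S)) {t : ℝ}
    (ht : t ∈ S) : Continuous fun x => g (x, t) :=
  hg.comp_continuous (by fun_prop) fun _ => ⟨mem_univ _, ht⟩

end Partial

/-- Differentiation under the integral sign for a balance law `f_t = g + F_x` whose flux vanishes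
at both ends of the interval. -/
lemma hasDerivAt_integral_of_balance {T a b : ℝ} {f F g : ℝ → ℝ → ℝ}
    (hf : ContDiffOn ℝ 1 (fun z : ℝ × ℝ => f z.1 z.2) (openStrip T))
    (hF : ContDiffOn ℝ 1 (fun z : ℝ × ℝ => F z.1 z.2) (openStrip T))
    (hbal : ∀ x, ∀ t ∈ Ioo 0 T, ∀ ft Fx : ℝ, HasDerivAt (fun s => f x s) ft t →
      HasDerivAt (fun y => F y t) Fx x → ft = g x t + Fx) {t : ℝ} (ht : t ∈ Ioo 0 T)
    (hFa : F a t = 0) (hFb : F b t = 0) :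
    HasDerivAt (fun t => ∫ x in a..b, f x t) (∫ x in a..b, g x t) t := by
  set f₂ : ℝ × ℝ → ℝ := fun z => f z.1 z.2 with hf₂
  set F₂ : ℝ × ℝ → ℝ := fun z => F z.1 z.2 with hF₂
  have hft := continuousOn_fderiv_apply hf (0, 1)
  have hFx := continuousOn_fderiv_apply hF (1, 0)
  obtain ⟨d, hd, hball⟩ := Metric.isOpen_iff.1 (isOpen_Ioo (a := (0 : ℝ)) (b := T)) t ht
  have hcl : Metric.closedBall t (d / 2) ⊆ Ioo 0 T :=
    (Metric.closedBall_subset_ball (by linarith)).trans hball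
  have hK : IsCompact (uIcc a b ×ˢ Metric.closedBall t (d / 2)) :=
    isCompact_uIcc.prod (isCompact_closedBall _ _)
  have hKsub : uIcc a b ×ˢ Metric.closedBall t (d / 2) ⊆ openStrip T :=
    prod_mono (subset_univ _) hcl
  obtain ⟨M, hM⟩ := hK.exists_bound_of_continuousOn (hft.mono hKsub)
  have hcont : ∀ s ∈ Ioo 0 T, Continuous fun x => f x s := fun s hs =>
    continuous_slice hf.continuousOn hs
  have hcont' : Continuous fun x => fderiv ℝ f₂ (x, t) (0, 1) := continuous_slice hft ht
  have hcontF : Continuous fun x => fderiv ℝ F₂ (x, t) (1, 0) := continuous_slice hFx ht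
  have hmain := (intervalIntegral.hasDerivAt_integral_of_dominated_loc_of_deriv_le
    (μ := volume) (a := a) (b := b) (F := fun s x => f x s)
    (F' := fun s x => fderiv ℝ f₂ (x, s) (0, 1)) (x₀ := t) (bound := fun _ => M)
    (s := Metric.closedBall t (d / 2)) (Metric.closedBall_mem_nhds t (by linarith))
    (by
      filter_upwards [isOpen_Ioo.mem_nhds ht] with s hs
      exact (hcont s hs).aestronglyMeasurable)
    ((hcont t ht).intervalIntegrable _ _)
    hcont'.aestronglyMeasurable
    (Eventually.of_forall fun x hx s hs => hM (x, s) ⟨uIoc_subset_uIcc hx, hs⟩)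
    (by simp)
    (Eventually.of_forall fun x _ s hs => hasDerivAt_time hf (hcl hs))).2
  refine hmain.congr_deriv ?_
  have hFint : ∫ x in a..b, fderiv ℝ F₂ (x, t) (1, 0) = 0 := by
    rw [intervalIntegral.integral_eq_sub_of_hasDerivAt (f := fun y => F y t)
      (fun x _ => hasDerivAt_space hF ht) (hcontF.intervalIntegrable _ _), hFa, hFb, sub_zero]
  have hg : ∀ x, g x t = fderiv ℝ f₂ (x, t) (0, 1) - fderiv ℝ F₂ (x, t) (1, 0) := by
    intro x
    rw [hbal x t ht _ _ (hasDerivAt_time hf ht) (hasDerivAt_space hF ht)]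
    ring
  simp_rw [hg]
  rw [intervalIntegral.integral_sub (hcont'.intervalIntegrable _ _)
    (hcontF.intervalIntegrable _ _), hFint, sub_zero]

lemma continuousOn_integral_closedStrip {T a b : ℝ} (hT : 0 ≤ T) {f : ℝ → ℝ → ℝ}
    (hf : ContinuousOn (fun z : ℝ × ℝ => f z.1 z.2) (closedStrip T)) :
    ContinuousOn (fun t => ∫ x in a..b, f x t) (Icc 0 T) := by
  have hc : Continuous (Function.uncurry fun (t : ℝ) (x : ℝ) => f x (projIcc 0 T hT t)) := by
    have : Continuous fun z : ℝ × ℝ => (z.2, (projIcc 0 T hT z.1 : ℝ)) := by fun_prop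
    exact hf.comp_continuous this fun z => mem_closedStrip (projIcc 0 T hT z.1).2
  have h := intervalIntegral.continuous_parametric_intervalIntegral_of_continuous' (μ := volume)
    hc a b
  refine h.continuousOn.congr fun t ht => ?_
  simp only [projIcc_of_mem hT ht]

/-- A classical solution of the damped Euler equations on the closed strip `ℝ × [0, T]`, without
initial condition: the finite-time form of `IsC1Solution` in which the estimates are carried out. -/
structure SolvesOn (γ μ T : ℝ) (ρ u : ℝ → ℝ → ℝ) : Prop where
  continuousOn_density : ContinuousOn (fun z : ℝ × ℝ => ρ z.1 z.2) (closedStrip T)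
  continuousOn_velocity : ContinuousOn (fun z : ℝ × ℝ => u z.1 z.2) (closedStrip T)
  contDiffOn_density : ContDiffOn ℝ 1 (fun z : ℝ × ℝ => ρ z.1 z.2) (openStrip T)
  contDiffOn_velocity : ContDiffOn ℝ 1 (fun z : ℝ × ℝ => u z.1 z.2) (openStrip T)
  density_pos : ∀ x, ∀ t ∈ Icc 0 T, 0 < ρ x t
  mass : ∀ x, ∀ t ∈ Ioo 0 T, ∀ ρt ρx ux : ℝ, HasDerivAt (fun s => ρ x s) ρt t →
    HasDerivAt (fun y => ρ y t) ρx x → HasDerivAt (fun y => u y t) ux x →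
    ρt + (ρx * u x t + ρ x t * ux) = 0
  momentum : ∀ x, ∀ t ∈ Ioo 0 T, ∀ ρt ρx ut ux : ℝ, HasDerivAt (fun s => ρ x s) ρt t →
    HasDerivAt (fun y => ρ y t) ρx x → HasDerivAt (fun s => u x s) ut t →
    HasDerivAt (fun y => u y t) ux x →
    ρt * u x t + ρ x t * ut + (ρx * u x t ^ 2 + ρ x t * (2 * u x t * ux))
      + ρ x t ^ (γ - 1) * ρx = -(μ / (1 + t)) * (ρ x t * u x t)

lemma hasDerivAt_pressure {γ ρ : ℝ} (hγ : 1 < γ) (hρ : 0 < ρ) :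
    HasDerivAt (pressure γ) (ρ ^ (γ - 1)) ρ := by
  have hγ0 : γ ≠ 0 := by linarith
  refine ((Real.hasDerivAt_rpow_const (p := γ) (Or.inl hρ.ne')).div_const γ).congr_deriv ?_
  field_simp

lemma IsC1Solution.solvesOn {γ μ ε : ℝ} {ρ₀ u₀ : ℝ → ℝ} {T : ℝ≥0∞} {ρ u : ℝ → ℝ → ℝ}
    (h : IsC1Solution γ μ ε ρ₀ u₀ T ρ u) (hγ : 1 < γ) {T₁ : ℝ} (hT : ENNReal.ofReal T₁ < T) :
    SolvesOn γ μ T₁ ρ u := by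
  have hlt : ∀ t, t ≤ T₁ → ENNReal.ofReal t < T := fun t ht =>
    lt_of_le_of_lt (ENNReal.ofReal_le_ofReal ht) hT
  have hsub : closedStrip T₁ ⊆ slab T := fun z hz => ⟨hz.2.1, hlt _ hz.2.2⟩
  have hsub' := (openStrip_subset T₁).trans hsub
  have h1 := h.contDiffOn_density.mono hsub'
  have h2 := h.contDiffOn_velocity.mono hsub'
  refine ⟨h.contDiffOn_density.continuousOn.mono hsub, h.contDiffOn_velocity.continuousOn.mono hsub,
    h1, h2, fun x t ht => h.density_pos x t ht.1 (hlt t ht.2), ?_, ?_⟩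
  · intro x t ht ρt ρx ux hρt hρx hux
    have := h.conservation_mass x t ht.1 (hlt t ht.2.le)
    rwa [hρt.deriv, (hρx.fun_mul hux).deriv] at this
  · intro x t ht ρt ρx ut ux hρt hρx hut hux
    have hpos := h.density_pos x t ht.1.le (hlt t ht.2.le)
    have := h.balance_momentum x t ht.1 (hlt t ht.2.le)
    have hp : HasDerivAt (fun y => pressure γ (ρ y t)) (ρ x t ^ (γ - 1) * ρx) x :=
      HasDerivAt.comp (h := fun y => ρ y t) x (hasDerivAt_pressure hγ hpos) hρx
    rw [(hρt.fun_mul hut).deriv, (hρx.fun_mul (hux.fun_pow 2)).deriv, hp.deriv] at this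
    rw [← this]
    push_cast
    ring

section Regularity

variable {γ μ T : ℝ} {ρ u : ℝ → ℝ → ℝ}

lemma SolvesOn.contDiffOn_pressure (h : SolvesOn γ μ T ρ u) :
    ContDiffOn ℝ 1 (fun z : ℝ × ℝ => pressure γ (ρ z.1 z.2)) (openStrip T) :=
  (h.contDiffOn_density.rpow_const_of_ne fun z hz =>
    (h.density_pos z.1 z.2 (Ioo_subset_Icc_self hz.2)).ne').div_const γ

lemma SolvesOn.continuousOn_pressure (h : SolvesOn γ μ T ρ u) :
    ContinuousOn (fun z : ℝ × ℝ => pressure γ (ρ z.1 z.2)) (closedStrip T) :=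
  (h.continuousOn_density.rpow_const fun z hz =>
    Or.inl (h.density_pos z.1 z.2 hz.2).ne').div_const γ

lemma SolvesOn.contDiffOn_energy (h : SolvesOn γ μ T ρ u) :
    ContDiffOn ℝ 1 (fun z : ℝ × ℝ => energy γ (ρ z.1 z.2) (u z.1 z.2)) (openStrip T) := by
  have h1 := h.contDiffOn_density
  have h2 := h.contDiffOn_velocity
  have h3 := h.contDiffOn_pressure
  unfold energy excess
  fun_prop

lemma SolvesOn.continuousOn_energy (h : SolvesOn γ μ T ρ u) :
    ContinuousOn (fun z : ℝ × ℝ => energy γ (ρ z.1 z.2) (u z.1 z.2)) (closedStrip T) := by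
  have h1 := h.continuousOn_density
  have h2 := h.continuousOn_velocity
  have h3 := h.continuousOn_pressure
  unfold energy excess
  fun_prop

end Regularity

lemma hasDerivAt_max_sq (x : ℝ) : HasDerivAt (fun x : ℝ => max x 0 ^ 2) (2 * max x 0) x := by
  rcases lt_trichotomy x 0 with h | h | h
  · refine ((hasDerivAt_const x (0 : ℝ)).congr_of_eventuallyEq ?_).congr_deriv ?_
    · filter_upwards [gt_mem_nhds h] with y hy
      rw [max_eq_right (le_of_lt hy)]
      norm_num
    · rw [max_eq_right h.le]
      norm_num
  · subst h
    rw [hasDerivAt_iff_isLittleO]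
    simp only [max_self, sub_zero, mul_zero, smul_zero]
    refine Asymptotics.IsBigO.trans_isLittleO (g := fun x : ℝ => x ^ 2)
      (Asymptotics.IsBigO.of_bound 1 (Eventually.of_forall fun x => ?_))
      (Asymptotics.isLittleO_pow_id one_lt_two)
    simp only [ne_eq, OfNat.ofNat_ne_zero, not_false_eq_true, zero_pow, sub_zero, norm_pow,
      Real.norm_eq_abs, one_mul]
    refine pow_le_pow_left₀ (abs_nonneg _) ?_ 2
    rw [abs_of_nonneg (le_max_right _ _)]
    exact max_le (le_abs_self _) (abs_nonneg _)
  · refine ((hasDerivAt_pow 2 x).congr_of_eventuallyEq ?_).congr_deriv ?_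
    · filter_upwards [lt_mem_nhds h] with y hy
      rw [max_eq_left (le_of_lt hy)]
    · rw [max_eq_left h.le]
      norm_num

lemma contDiff_max_sq : ContDiff ℝ 1 fun x : ℝ => max x 0 ^ 2 := by
  rw [contDiff_one_iff_deriv]
  refine ⟨fun x => (hasDerivAt_max_sq x).differentiableAt, ?_⟩
  have : deriv (fun x : ℝ => max x 0 ^ 2) = fun x => 2 * max x 0 :=
    funext fun x => (hasDerivAt_max_sq x).deriv
  rw [this]
  fun_prop

/-- A `C¹` cutoff which is positive exactly on the trapezoid `a + σ t < x < b - σ t`. -/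
noncomputable def cutoff (σ a b x t : ℝ) : ℝ :=
  max (x - a - σ * t) 0 ^ 2 * max (b - σ * t - x) 0 ^ 2

lemma contDiff_cutoff (σ a b : ℝ) : ContDiff ℝ 1 fun z : ℝ × ℝ => cutoff σ a b z.1 z.2 := by
  have h1 : ContDiff ℝ 1 fun z : ℝ × ℝ => max (z.1 - a - σ * z.2) 0 ^ 2 :=
    contDiff_max_sq.comp (by fun_prop)
  have h2 : ContDiff ℝ 1 fun z : ℝ × ℝ => max (b - σ * z.2 - z.1) 0 ^ 2 :=
    contDiff_max_sq.comp (by fun_prop)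
  exact h1.mul h2

lemma cutoff_nonneg (σ a b x t : ℝ) : 0 ≤ cutoff σ a b x t := by unfold cutoff; positivity

lemma cutoff_pos {σ a b x t : ℝ} (h1 : a + σ * t < x) (h2 : x < b - σ * t) :
    0 < cutoff σ a b x t := by
  have h1' : 0 < max (x - a - σ * t) 0 := lt_max_of_lt_left (by linarith)
  have h2' : 0 < max (b - σ * t - x) 0 := lt_max_of_lt_left (by linarith)
  unfold cutoff
  positivity

/-- Balance of energy against a cutoff. The source term is bounded by the energy flux through the
moving edges of the cutoff and by the (dissipative) damping. -/
lemma SolvesOn.energy_balance {γ μ T σ a b : ℝ} {ρ u : ℝ → ℝ → ℝ} (h : SolvesOn γ μ T ρ u)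
    (hγ : 1 < γ) {t : ℝ} (ht : t ∈ Ioo 0 T)
    (hσ : 0 ≤ σ) :
    HasDerivAt (fun t => ∫ x in a..b, energy γ (ρ x t) (u x t) * cutoff σ a b x t)
      (∫ x in a..b,
        ((u x t * (energy γ (ρ x t) (u x t) + (pressure γ (ρ x t) - 1 / γ)))
          * (2 * max (x - a - σ * t) 0 * max (b - σ * t - x) 0 ^ 2
            - 2 * max (x - a - σ * t) 0 ^ 2 * max (b - σ * t - x) 0)
        - σ * energy γ (ρ x t) (u x t)
          * (2 * max (x - a - σ * t) 0 * max (b - σ * t - x) 0 ^ 2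
            + 2 * max (x - a - σ * t) 0 ^ 2 * max (b - σ * t - x) 0)
        - μ / (1 + t) * (ρ x t * u x t ^ 2) * cutoff σ a b x t)) t := by
  have hρ := h.contDiffOn_density
  have hu := h.contDiffOn_velocity
  have hp := h.contDiffOn_pressure
  have he := h.contDiffOn_energy
  have hχ := (contDiff_cutoff σ a b).contDiffOn (s := openStrip T)
  have ht0 := ht.1
  refine hasDerivAt_integral_of_balance
    (f := fun x t => energy γ (ρ x t) (u x t) * cutoff σ a b x t)
    (F := fun x t => -(u x t * (energy γ (ρ x t) (u x t) + (pressure γ (ρ x t) - 1 / γ))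
      * cutoff σ a b x t))
    (g := fun x t => ((u x t * (energy γ (ρ x t) (u x t) + (pressure γ (ρ x t) - 1 / γ)))
          * (2 * max (x - a - σ * t) 0 * max (b - σ * t - x) 0 ^ 2
            - 2 * max (x - a - σ * t) 0 ^ 2 * max (b - σ * t - x) 0)
        - σ * energy γ (ρ x t) (u x t)
          * (2 * max (x - a - σ * t) 0 * max (b - σ * t - x) 0 ^ 2
            + 2 * max (x - a - σ * t) 0 ^ 2 * max (b - σ * t - x) 0)
        - μ / (1 + t) * (ρ x t * u x t ^ 2) * cutoff σ a b x t)) (he.mul hχ) (by fun_prop) ?_ ht ?_ ?_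
  · intro x t ht ft Fx hft hFx
    have hpos := h.density_pos x t (Ioo_subset_Icc_self ht)
    have hρt := hasDerivAt_time hρ (x := x) ht
    have hρx := hasDerivAt_space hρ (x := x) ht
    have hut := hasDerivAt_time hu (x := x) ht
    have hux := hasDerivAt_space hu (x := x) ht
    have hmass := h.mass x t ht _ _ _ hρt hρx hux
    have hmom := h.momentum x t ht _ _ _ _ hρt hρx hut hux
    generalize fderiv ℝ (fun z : ℝ × ℝ => ρ z.1 z.2) (x, t) (0, 1) = ρt at *
    generalize fderiv ℝ (fun z : ℝ × ℝ => ρ z.1 z.2) (x, t) (1, 0) = ρx at *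
    generalize fderiv ℝ (fun z : ℝ × ℝ => u z.1 z.2) (x, t) (0, 1) = ut at *
    generalize fderiv ℝ (fun z : ℝ × ℝ => u z.1 z.2) (x, t) (1, 0) = ux at *
    have hex := hasDerivAt_excess hγ hpos
    have hpr := hasDerivAt_pressure hγ hpos
    have het : HasDerivAt (fun s => energy γ (ρ x s) (u x s)) _ t :=
      ((hρt.fun_mul (hut.fun_pow 2)).div_const 2).fun_add
        ((HasDerivAt.comp (h := fun s => ρ x s) t hex hρt).div_const (γ - 1))
    have hexx : HasDerivAt (fun y => energy γ (ρ y t) (u y t)) _ x :=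
      ((hρx.fun_mul (hux.fun_pow 2)).div_const 2).fun_add
        ((HasDerivAt.comp (h := fun y => ρ y t) x hex hρx).div_const (γ - 1))
    have hpx : HasDerivAt (fun y => pressure γ (ρ y t)) _ x :=
      HasDerivAt.comp (h := fun y => ρ y t) x hpr hρx
    have hχt : HasDerivAt (fun s => cutoff σ a b x s) _ t :=
      (HasDerivAt.comp (h := fun s => x - a - σ * s) t (hasDerivAt_max_sq (x - a - σ * t))
        (((hasDerivAt_id t).const_mul σ).const_sub (x - a))).fun_mul
      (HasDerivAt.comp (h := fun s => b - σ * s - x) t (hasDerivAt_max_sq (b - σ * t - x))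
        ((((hasDerivAt_id t).const_mul σ).const_sub b).sub_const x))
    have hχx : HasDerivAt (fun y => cutoff σ a b y t) _ x :=
      (HasDerivAt.comp (h := fun y => y - a - σ * t) x (hasDerivAt_max_sq (x - a - σ * t))
        (((hasDerivAt_id x).sub_const a).sub_const (σ * t))).fun_mul
      (HasDerivAt.comp (h := fun y => b - σ * t - y) x (hasDerivAt_max_sq (b - σ * t - x))
        ((hasDerivAt_id x).const_sub (b - σ * t)))
    have e1 := hft.unique (het.fun_mul hχt)
    have e2 := hFx.unique (((hux.fun_mul (hexx.fun_add (hpx.sub_const (1 / γ)))).fun_mul hχx).fun_neg)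
    rw [e1, e2]
    have hγ0 : γ ≠ 0 := by linarith
    have hγ1 : γ - 1 ≠ 0 := by linarith
    have hτ : 1 + t ≠ 0 := by linarith [ht.1]
    have hrp : ρ x t ^ γ = ρ x t ^ (γ - 1) * ρ x t := by
      rw [← Real.rpow_add_one hpos.ne']; simp
    simp only [Function.comp, cutoff, energy, excess, pressure, hrp]
    generalize max (x - a - σ * t) 0 = A
    generalize max (b - σ * t - x) 0 = B
    generalize ρ x t ^ (γ - 1) = P at *
    generalize ρ x t = r at *
    generalize u x t = v at *
    push_cast
    -- the energy identity: the momentum equation times `u` plus the mass equation times the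
    -- derivative of the energy with respect to `ρ` at fixed momentum
    linear_combination (norm := (field_simp; ring)) (A ^ 2 * B ^ 2) *
      (v * hmom + ((P - 1) / (γ - 1) - v ^ 2 / 2) * hmass)
  · have : 0 ≤ σ * t := by positivity
    simp [cutoff, this]
  · have : 0 ≤ σ * t := by positivity
    simp [cutoff, this]

/-- Finite speed of propagation, in a truncated region whose edges move with a speed `σ` larger than
the sound speed `1` of the rest state. -/
lemma SolvesOn.energy_integral_eq_zero {γ μ T σ a b : ℝ} {ρ u : ℝ → ℝ → ℝ}
    (h : SolvesOn γ μ T ρ u) (hγ : 1 < γ) (hμ : 0 ≤ μ) (hT : 0 ≤ T) (hσ : 1 < σ) (hab : a < b)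
    (hρ0 : ∀ x, a < x → ρ x 0 = 1) (hu0 : ∀ x, a < x → u x 0 = 0) {t : ℝ} (ht : t ∈ Icc 0 T) :
    ∫ x in a..b, energy γ (ρ x t) (u x t) * cutoff σ a b x t = 0 := by
  have hint : ContinuousOn (fun z : ℝ × ℝ => energy γ (ρ z.1 z.2) (u z.1 z.2) * cutoff σ a b z.1 z.2)
      (closedStrip T) := h.continuousOn_energy.mul (contDiff_cutoff σ a b).continuous.continuousOn
  have hEc : ContinuousOn (fun t => ∫ x in a..b, energy γ (ρ x t) (u x t) * cutoff σ a b x t)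
      (Icc 0 T) := continuousOn_integral_closedStrip
        (f := fun x t => energy γ (ρ x t) (u x t) * cutoff σ a b x t) hT hint
  have hnn : ∀ t ∈ Icc 0 T, ∀ x, 0 ≤ energy γ (ρ x t) (u x t) * cutoff σ a b x t :=
    fun t ht x => mul_nonneg (energy_nonneg hγ (h.density_pos x t ht)) (cutoff_nonneg _ _ _ _ _)
  have hEnn : ∀ t ∈ Icc 0 T, 0 ≤ ∫ x in a..b, energy γ (ρ x t) (u x t) * cutoff σ a b x t :=
    fun t ht => intervalIntegral.integral_nonneg hab.le fun x _ => hnn t ht x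
  -- The flux estimate only holds near the rest state, so the vanishing of the integral is
  -- continued in time: the set of times where it vanishes is closed, and open to the right.
  set E : ℝ → ℝ := fun t => ∫ x in a..b, energy γ (ρ x t) (u x t) * cutoff σ a b x t with hE
  have hclosed : IsClosed ({t | E t = 0} ∩ Icc 0 T) := by
    rw [inter_comm]
    exact hEc.preimage_isClosed_of_isClosed isClosed_Icc isClosed_singleton
  refine hclosed.Icc_subset_of_forall_exists_gt ?_ ?_ ht
  · change E 0 = 0
    simp only [hE]
    rw [intervalIntegral.integral_congr_ae (g := fun _ => 0)]
    · simp
    · refine Eventually.of_forall fun x hx => ?_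
      rw [uIoc_of_le hab.le] at hx
      rw [hρ0 x hx.1, hu0 x hx.1]
      simp [energy]
  · rintro t₀ ⟨ht₀, ht₀T⟩ y hy
    have ht₀' : t₀ ∈ Icc 0 T := Ico_subset_Icc_self ht₀T
    obtain ⟨δ, hδ, hflux⟩ := exists_abs_flux_le hγ hσ
    -- at time `t₀` the solution is at rest inside the trapezoid
    have hrest : ∀ x, a + σ * t₀ < x → x < b - σ * t₀ → ρ x t₀ = 1 ∧ u x t₀ = 0 := by
      intro x hx1 hx2
      have h0 : 0 ≤ σ * t₀ := mul_nonneg (by linarith) ht₀'.1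
      have hpos := h.density_pos x t₀ ht₀'
      apply eq_of_energy_eq_zero hγ hpos
      by_contra hne
      have hlt : 0 < energy γ (ρ x t₀) (u x t₀) * cutoff σ a b x t₀ :=
        mul_pos (lt_of_le_of_ne (energy_nonneg hγ hpos) (Ne.symm hne)) (cutoff_pos hx1 hx2)
      have := intervalIntegral.integral_pos hab
        (continuous_slice hint ht₀').continuousOn (fun x _ => hnn t₀ ht₀' x)
        ⟨x, ⟨by linarith, by linarith⟩, hlt⟩
      exact this.ne' ht₀
    -- hence it is close to rest in the smaller slices shortly afterwards
    have hK : IsCompact (Icc a b ×ˢ Icc 0 T) := isCompact_Icc.prod isCompact_Icc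
    have hKs : Icc a b ×ˢ Icc 0 T ⊆ closedStrip T := prod_mono (subset_univ _) le_rfl
    obtain ⟨d₁, hd₁, hd₁'⟩ := Metric.uniformContinuousOn_iff.1
      (hK.uniformContinuousOn_of_continuous (h.continuousOn_density.mono hKs)) δ hδ
    obtain ⟨d₂, hd₂, hd₂'⟩ := Metric.uniformContinuousOn_iff.1
      (hK.uniformContinuousOn_of_continuous (h.continuousOn_velocity.mono hKs)) δ hδ
    set t₁ := min y (min T (t₀ + min d₁ d₂ / 2)) with ht₁
    have hdmin : 0 < min d₁ d₂ := lt_min hd₁ hd₂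
    have h01 : t₀ < t₁ := lt_min hy (lt_min ht₀T.2 (by linarith))
    have h1T : t₁ ≤ T := (min_le_right _ _).trans (min_le_left _ _)
    have h1d : t₁ ≤ t₀ + min d₁ d₂ / 2 := (min_le_right _ _).trans (min_le_right _ _)
    have hanti : AntitoneOn E (Icc t₀ t₁) := by
      have hder : ∀ t ∈ Ioo t₀ t₁, t ∈ Ioo 0 T := fun t ht =>
        ⟨lt_of_le_of_lt ht₀'.1 ht.1, lt_of_lt_of_le ht.2 h1T⟩
      apply antitoneOn_of_deriv_nonpos (convex_Icc _ _)
      · exact hEc.mono (Icc_subset_Icc ht₀'.1 h1T)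
      · rw [interior_Icc]
        intro t ht
        exact (h.energy_balance hγ (hder t ht) (by linarith)).differentiableAt.differentiableWithinAt
      · rw [interior_Icc]
        intro t ht
        have ht' := hder t ht
        have htI := Ioo_subset_Icc_self ht'
        rw [(h.energy_balance hγ ht' (by linarith)).deriv, ← neg_nonneg,
          ← intervalIntegral.integral_neg]
        refine intervalIntegral.integral_nonneg hab.le fun x hx => ?_
        have hpos := h.density_pos x t htI
        have hχ := cutoff_nonneg σ a b x t
        have hdamp : 0 ≤ μ / (1 + t) * (ρ x t * u x t ^ 2) * cutoff σ a b x t := by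
          have := ht'.1
          positivity
        have hσt : σ * t₀ ≤ σ * t := by
          have := ht.1.le
          gcongr
        by_cases hin : a + σ * t < x ∧ x < b - σ * t
        · have hr := hrest x (by linarith [hin.1]) (by linarith [hin.2])
          have hdist : dist (x, t) (x, t₀) < min d₁ d₂ := by
            rw [Prod.dist_eq, dist_self, Real.dist_eq,
              abs_of_pos (by linarith [ht.1])]
            exact max_lt hdmin (by linarith [ht.2])
          have c1 := hd₁' (x, t) ⟨hx, htI⟩ (x, t₀) ⟨hx, ht₀'⟩ (hdist.trans_le (min_le_left _ _))
          have c2 := hd₂' (x, t) ⟨hx, htI⟩ (x, t₀) ⟨hx, ht₀'⟩ (hdist.trans_le (min_le_right _ _))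
          simp only [hr.1, hr.2, Real.dist_eq, sub_zero] at c1 c2
          have hf := abs_le.1 (hflux _ _ c1 c2)
          have hA : 0 ≤ 2 * max (x - a - σ * t) 0 * max (b - σ * t - x) 0 ^ 2 := by positivity
          have hB : 0 ≤ 2 * max (x - a - σ * t) 0 ^ 2 * max (b - σ * t - x) 0 := by positivity
          nlinarith [mul_nonneg (sub_nonneg.2 hf.2) hA,
            mul_nonneg (by linarith [hf.1] : 0 ≤ σ * energy γ (ρ x t) (u x t) +
              u x t * (energy γ (ρ x t) (u x t) + (pressure γ (ρ x t) - 1 / γ))) hB]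
        · have hz : max (x - a - σ * t) 0 = 0 ∨ max (b - σ * t - x) 0 = 0 := by
            rw [not_and_or, not_lt, not_lt] at hin
            rcases hin with h | h
            · exact Or.inl (max_eq_right (by linarith))
            · exact Or.inr (max_eq_right (by linarith))
          rcases hz with hz | hz <;> simp only [hz] <;> simp <;> linarith
    refine ⟨t₁, ?_, h01, min_le_left _ _⟩
    have h1 := hanti (left_mem_Icc.2 h01.le) (right_mem_Icc.2 h01.le) h01.le
    have h0 : E t₀ = 0 := ht₀
    exact le_antisymm (h1.trans h0.le) (hEnn t₁ ⟨ht₀'.1.trans h01.le, h1T⟩)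

/-- Finite speed of propagation: disturbances of the rest state travel to the right at most with the
sound speed `1`. -/
theorem SolvesOn.eq_rest {γ μ T R : ℝ} {ρ u : ℝ → ℝ → ℝ}
    (h : SolvesOn γ μ T ρ u) (hγ : 1 < γ) (hμ : 0 ≤ μ) (hT : 0 ≤ T)
    (hρ0 : ∀ x, R < x → ρ x 0 = 1) (hu0 : ∀ x, R < x → u x 0 = 0) {x t : ℝ} (ht : t ∈ Icc 0 T)
    (hx : R + t < x) : ρ x t = 1 ∧ u x t = 0 := by
  have ht0 := ht.1
  -- a supersonic edge speed for which the point `(x, t)` still lies inside the trapezoid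
  set σ := 1 + (x - R - t) / (2 * (t + 1)) with hσ
  have hq : 0 < (x - R - t) / (2 * (t + 1)) := div_pos (by linarith) (by linarith)
  have hσ1 : 1 < σ := by linarith
  have hx1 : R + σ * t < x := by
    have : (x - R - t) / (2 * (t + 1)) * t < x - R - t := by
      rw [div_mul_eq_mul_div, div_lt_iff₀ (by linarith)]
      nlinarith
    rw [hσ, add_mul]
    linarith
  set b := x + σ * t + 1 with hb
  have hσt : 0 ≤ σ * t := by positivity
  have hint : ContinuousOn (fun z : ℝ × ℝ => energy γ (ρ z.1 z.2) (u z.1 z.2) * cutoff σ R b z.1 z.2)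
      (closedStrip T) := h.continuousOn_energy.mul (contDiff_cutoff σ R b).continuous.continuousOn
  have hpos := h.density_pos x t ht
  apply eq_of_energy_eq_zero hγ hpos
  by_contra hne
  have hlt : 0 < energy γ (ρ x t) (u x t) * cutoff σ R b x t :=
    mul_pos (lt_of_le_of_ne (energy_nonneg hγ hpos) (Ne.symm hne))
      (cutoff_pos hx1 (by linarith))
  have hRb : R < b := by linarith
  have hint_pos := intervalIntegral.integral_pos hRb
    (continuous_slice hint ht).continuousOn
    (fun x _ => mul_nonneg (energy_nonneg hγ (h.density_pos x t ht)) (cutoff_nonneg _ _ _ _ _))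
    ⟨x, ⟨by linarith, by linarith⟩, hlt⟩
  exact hint_pos.ne' (h.energy_integral_eq_zero hγ hμ hT hσ1 hRb hρ0 hu0 ht)

/-! ### The test wave -/

/-- The homogeneous extension `τ ^ (i - κ) Φ i (ξ)` of a profile, where `τ = 1 + t` and
`ξ = (x + 1 - R₀) / τ`. It vanishes for `x ≤ R₀ + t`. -/
noncomputable def wave (κ R₀ : ℝ) (Φ : ℕ → ℝ → ℝ) (i : ℕ) (x t : ℝ) : ℝ :=
  (1 + t) ^ ((i : ℝ) - κ) * Φ i ((x + 1 - R₀) / (1 + t))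

/-- The time derivative of `wave κ R₀ Φ 4`, by Euler's identity for homogeneous functions. -/
noncomputable def waveTime (κ R₀ : ℝ) (Φ : ℕ → ℝ → ℝ) (x t : ℝ) : ℝ :=
  ((4 - κ) * wave κ R₀ Φ 4 x t - (x + 1 - R₀) * wave κ R₀ Φ 3 x t) / (1 + t)

section Wave

variable {κ L C R₀ : ℝ} {Φ : ℕ → ℝ → ℝ}

lemma IsProfile.hasDerivAt_wave_space (h : IsProfile κ L C Φ) {i : ℕ} (hi : 1 ≤ i) {x t : ℝ}
    (ht : 0 ≤ t) : HasDerivAt (fun y => wave κ R₀ Φ (i + 1) y t) (wave κ R₀ Φ i x t) x := by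
  have hτ : 0 < 1 + t := by linarith
  have hin : HasDerivAt (fun y : ℝ => (y + 1 - R₀) / (1 + t)) (1 / (1 + t)) x :=
    (((hasDerivAt_id x).add_const 1).sub_const R₀).div_const _
  have hc := (HasDerivAt.comp (h := fun y : ℝ => (y + 1 - R₀) / (1 + t)) x
    (h.hasDerivAt i hi _) hin).const_mul ((1 + t) ^ (((i + 1 : ℕ) : ℝ) - κ))
  refine hc.congr_deriv ?_
  have e : (1 + t) ^ (((i + 1 : ℕ) : ℝ) - κ) = (1 + t) ^ ((i : ℝ) - κ) * (1 + t) := by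
    rw [← Real.rpow_add_one hτ.ne']
    congr 1
    push_cast
    ring
  rw [e, wave]
  field_simp

lemma IsProfile.hasDerivAt_wave_time (h : IsProfile κ L C Φ) {i : ℕ} (hi : 1 ≤ i) {x t : ℝ}
    (ht : 0 ≤ t) : HasDerivAt (fun s => wave κ R₀ Φ (i + 1) x s)
      (((i + 1 - κ) * wave κ R₀ Φ (i + 1) x t - (x + 1 - R₀) * wave κ R₀ Φ i x t) / (1 + t)) t := by
  have hτ : 0 < 1 + t := by linarith
  have hτ' : HasDerivAt (fun s : ℝ => 1 + s) 1 t := (hasDerivAt_id t).const_add 1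
  have hin : HasDerivAt (fun s : ℝ => (x + 1 - R₀) / (1 + s)) (-(x + 1 - R₀) / (1 + t) ^ 2) t := by
    refine ((hasDerivAt_const t (x + 1 - R₀)).fun_div hτ' hτ.ne').congr_deriv ?_
    ring
  have hc := (hτ'.rpow_const (p := ((i + 1 : ℕ) : ℝ) - κ) (Or.inl hτ.ne')).fun_mul
    (HasDerivAt.comp (h := fun s : ℝ => (x + 1 - R₀) / (1 + s)) t (h.hasDerivAt i hi _) hin)
  refine hc.congr_deriv ?_
  simp only [Function.comp, wave]
  have e : (1 + t) ^ (((i + 1 : ℕ) : ℝ) - κ) = (1 + t) ^ ((i : ℝ) - κ) * (1 + t) := by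
    rw [← Real.rpow_add_one hτ.ne']
    congr 1
    push_cast
    ring
  rw [Real.rpow_sub_one hτ.ne', e]
  push_cast
  field_simp
  ring

/-- The test function solves the damped wave equation (Euler–Poisson–Darboux equation)
`k_tt + (2 κ / (1 + t)) k_t = k_xx`. -/
lemma IsProfile.hasDerivAt_waveTime_time (h : IsProfile κ L C Φ) {x t : ℝ} (ht : 0 ≤ t) :
    HasDerivAt (fun s => waveTime κ R₀ Φ x s)
      (wave κ R₀ Φ 2 x t - 2 * κ / (1 + t) * waveTime κ R₀ Φ x t) t := by
  have hτ : 0 < 1 + t := by linarith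
  have hτ' : HasDerivAt (fun s : ℝ => 1 + s) 1 t := (hasDerivAt_id t).const_add 1
  have h4 := h.hasDerivAt_wave_time (R₀ := R₀) (i := 3) (by norm_num) (x := x) ht
  have h3 := h.hasDerivAt_wave_time (R₀ := R₀) (i := 2) (by norm_num) (x := x) ht
  have hc := ((h4.const_mul (4 - κ)).fun_sub (h3.const_mul (x + 1 - R₀))).fun_div hτ' hτ.ne'
  refine hc.congr_deriv ?_
  have hode : ((x + 1 - R₀) ^ 2 - (1 + t) ^ 2) * wave κ R₀ Φ 2 x t
      - 6 * (x + 1 - R₀) * wave κ R₀ Φ 3 x t + (4 - κ) * (3 + κ) * wave κ R₀ Φ 4 x t = 0 := by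
    have e3 : (1 + t) ^ (((3 : ℕ) : ℝ) - κ) = (1 + t) ^ (((2 : ℕ) : ℝ) - κ) * (1 + t) := by
      rw [← Real.rpow_add_one hτ.ne']
      congr 1
      push_cast
      ring
    have e4 : (1 + t) ^ (((4 : ℕ) : ℝ) - κ) = (1 + t) ^ (((2 : ℕ) : ℝ) - κ) * (1 + t) ^ 2 := by
      rw [← Real.rpow_add_natCast hτ.ne']
      congr 1
      push_cast
      ring
    have ho := h.ode ((x + 1 - R₀) / (1 + t))
    unfold wave
    rw [e3, e4]
    generalize (1 + t) ^ (((2 : ℕ) : ℝ) - κ) = P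
    generalize Φ 2 ((x + 1 - R₀) / (1 + t)) = p2 at *
    generalize Φ 3 ((x + 1 - R₀) / (1 + t)) = p3 at *
    generalize Φ 4 ((x + 1 - R₀) / (1 + t)) = p4 at *
    have : P * (1 + t) ^ 2 * (((x + 1 - R₀) / (1 + t)) ^ 2 - 1) * p2 =
        P * ((x + 1 - R₀) ^ 2 - (1 + t) ^ 2) * p2 := by field_simp
    have h2 : P * (1 + t) ^ 2 * (6 * ((x + 1 - R₀) / (1 + t)) * p3) =
        P * (1 + t) * 6 * (x + 1 - R₀) * p3 := by field_simp
    linear_combination P * (1 + t) ^ 2 * ho - this + h2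
  unfold waveTime
  generalize wave κ R₀ Φ 2 x t = k2 at *
  generalize wave κ R₀ Φ (2 + 1) x t = k3 at *
  generalize wave κ R₀ Φ (3 + 1) x t = k4 at *
  push_cast
  field_simp
  linear_combination hode

lemma IsProfile.hasDerivAt_waveTime_space (h : IsProfile κ L C Φ) {x t : ℝ} (ht : 0 ≤ t) :
    HasDerivAt (fun y => waveTime κ R₀ Φ y t)
      (((3 - κ) * wave κ R₀ Φ 3 x t - (x + 1 - R₀) * wave κ R₀ Φ 2 x t) / (1 + t)) x := by
  have h4 := h.hasDerivAt_wave_space (R₀ := R₀) (i := 3) (by norm_num) (x := x) ht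
  have h3 := h.hasDerivAt_wave_space (R₀ := R₀) (i := 2) (by norm_num) (x := x) ht
  have hX : HasDerivAt (fun y : ℝ => y + 1 - R₀) 1 x :=
    ((hasDerivAt_id x).add_const 1).sub_const R₀
  refine (((h4.const_mul (4 - κ)).fun_sub (hX.fun_mul h3)).div_const (1 + t)).congr_deriv ?_
  ring

lemma IsProfile.contDiffOn_wave (h : IsProfile κ L C Φ) {i : ℕ} (hi : 1 ≤ i) (T : ℝ) :
    ContDiffOn ℝ 1 (fun z : ℝ × ℝ => wave κ R₀ Φ (i + 1) z.1 z.2) (openStrip T) := by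
  have hΦ : ContDiff ℝ 1 (Φ (i + 1)) := by
    rw [contDiff_one_iff_deriv]
    refine ⟨fun ξ => (h.hasDerivAt i hi ξ).differentiableAt, ?_⟩
    rw [show deriv (Φ (i + 1)) = Φ i from funext fun ξ => (h.hasDerivAt i hi ξ).deriv]
    exact h.continuous i hi
  have hne : ∀ z ∈ openStrip T, 1 + z.2 ≠ 0 := fun z hz => by
    have := hz.2.1
    linarith
  have h1 : ContDiffOn ℝ 1 (fun z : ℝ × ℝ => (1 + z.2) ^ (((i + 1 : ℕ) : ℝ) - κ)) (openStrip T) :=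
    ContDiffOn.rpow_const_of_ne (by fun_prop) hne
  have h2 : ContDiffOn ℝ 1 (fun z : ℝ × ℝ => (z.1 + 1 - R₀) / (1 + z.2)) (openStrip T) :=
    ContDiffOn.div (by fun_prop) (by fun_prop) hne
  exact h1.mul (hΦ.comp_contDiffOn h2)

lemma IsProfile.continuousOn_wave (h : IsProfile κ L C Φ) {i : ℕ} (hi : 1 ≤ i) (T : ℝ) :
    ContinuousOn (fun z : ℝ × ℝ => wave κ R₀ Φ i z.1 z.2) (closedStrip T) := by
  have hne : ∀ z ∈ closedStrip T, 1 + z.2 ≠ 0 := fun z hz => by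
    have := hz.2.1
    linarith
  have h1 : ContinuousOn (fun z : ℝ × ℝ => (1 + z.2) ^ ((i : ℝ) - κ)) (closedStrip T) :=
    ContinuousOn.rpow_const (by fun_prop) fun z hz => Or.inl (hne z hz)
  have h2 : ContinuousOn (fun z : ℝ × ℝ => (z.1 + 1 - R₀) / (1 + z.2)) (closedStrip T) :=
    ContinuousOn.div (by fun_prop) (by fun_prop) hne
  exact h1.mul ((h.continuous i hi).comp_continuousOn h2)

lemma IsProfile.contDiffOn_waveTime (h : IsProfile κ L C Φ) (T : ℝ) :
    ContDiffOn ℝ 1 (fun z : ℝ × ℝ => waveTime κ R₀ Φ z.1 z.2) (openStrip T) := by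
  have h4 := h.contDiffOn_wave (R₀ := R₀) (i := 3) (by norm_num) T
  have h3 := h.contDiffOn_wave (R₀ := R₀) (i := 2) (by norm_num) T
  refine ContDiffOn.div (by fun_prop) (by fun_prop) fun z hz => ?_
  have := hz.2.1
  linarith

lemma IsProfile.continuousOn_waveTime (h : IsProfile κ L C Φ) (T : ℝ) :
    ContinuousOn (fun z : ℝ × ℝ => waveTime κ R₀ Φ z.1 z.2) (closedStrip T) := by
  have h4 := h.continuousOn_wave (R₀ := R₀) (i := 4) (by norm_num) T
  have h3 := h.continuousOn_wave (R₀ := R₀) (i := 3) (by norm_num) T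
  refine ContinuousOn.div (by fun_prop) (by fun_prop) fun z hz => ?_
  have := hz.2.1
  linarith

lemma IsProfile.wave_eq_zero (h : IsProfile κ L C Φ) {i : ℕ} (hi : 1 ≤ i) {x t : ℝ} (ht : 0 ≤ t)
    (hx : x ≤ R₀ + t) : wave κ R₀ Φ i x t = 0 := by
  rw [wave, h.eq_zero i hi _ (by rw [div_le_one (by linarith)]; linarith), mul_zero]

lemma IsProfile.waveTime_eq_zero (h : IsProfile κ L C Φ) {x t : ℝ} (ht : 0 ≤ t)
    (hx : x ≤ R₀ + t) : waveTime κ R₀ Φ x t = 0 := by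
  rw [waveTime, h.wave_eq_zero (by norm_num) ht hx, h.wave_eq_zero (by norm_num) ht hx]
  simp

lemma IsProfile.wave_nonneg (h : IsProfile κ L C Φ) {i : ℕ} (hi : 1 ≤ i) {x t : ℝ} (ht : 0 ≤ t) :
    0 ≤ wave κ R₀ Φ i x t :=
  mul_nonneg (Real.rpow_nonneg (by linarith) _) (h.nonneg i hi _)

lemma IsProfile.wave_succ_le (h : IsProfile κ L C Φ) {i : ℕ} (hi : 1 ≤ i) {x t : ℝ} (ht : 0 ≤ t)
    (hx : R₀ + t ≤ x) : wave κ R₀ Φ (i + 1) x t ≤ (x - R₀ - t) * wave κ R₀ Φ i x t := by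
  have hτ : 0 < 1 + t := by linarith
  have h1 := h.le_mul i hi ((x + 1 - R₀) / (1 + t)) (by rw [le_div_iff₀ hτ]; linarith)
  have e : (1 + t) ^ (((i + 1 : ℕ) : ℝ) - κ) = (1 + t) ^ ((i : ℝ) - κ) * (1 + t) := by
    rw [← Real.rpow_add_one hτ.ne']
    congr 1
    push_cast
    ring
  unfold wave
  rw [e]
  have h2 : 0 < (1 + t) ^ ((i : ℝ) - κ) * (1 + t) := by positivity
  refine (mul_le_mul_of_nonneg_left h1 h2.le).trans (le_of_eq ?_)
  generalize Φ i ((x + 1 - R₀) / (1 + t)) = p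
  field_simp
  ring

/-- In the strip `R₀ + t ≤ x ≤ R₀ + L + t` the test function and its time derivative are controlled
by its second space derivative, which decays like `(1 + t) ^ (-κ)`. -/
lemma IsProfile.wave_bounds (h : IsProfile κ L C Φ) (h0 : 0 ≤ κ) (h1 : κ ≤ 1) (hL : 0 ≤ L)
    (hC : 0 ≤ C) {x t : ℝ} (ht : 0 ≤ t) (hx : R₀ + t ≤ x) (hx' : x ≤ R₀ + L + t) :
    wave κ R₀ Φ 4 x t ≤ L ^ 2 * wave κ R₀ Φ 2 x t ∧
    |waveTime κ R₀ Φ x t| ≤ (5 * L ^ 2 + L) * wave κ R₀ Φ 2 x t ∧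
    wave κ R₀ Φ 2 x t ≤ C * L ^ 2 * (1 + t) ^ (-κ) := by
  have hτ : 0 < 1 + t := by linarith
  have k2 := h.wave_nonneg (R₀ := R₀) (i := 2) (by norm_num) (x := x) ht
  have k3 := h.wave_nonneg (R₀ := R₀) (i := 3) (by norm_num) (x := x) ht
  have k4 := h.wave_nonneg (R₀ := R₀) (i := 4) (by norm_num) (x := x) ht
  have h3 := h.wave_succ_le (i := 2) (by norm_num) ht hx
  have h4 := h.wave_succ_le (i := 3) (by norm_num) ht hx
  have hd0 : 0 ≤ x - R₀ - t := by linarith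
  have hdL : x - R₀ - t ≤ L := by linarith
  have h3' : wave κ R₀ Φ 3 x t ≤ L * wave κ R₀ Φ 2 x t :=
    h3.trans (mul_le_mul_of_nonneg_right hdL k2)
  have h4' : wave κ R₀ Φ 4 x t ≤ L ^ 2 * wave κ R₀ Φ 2 x t := by
    calc wave κ R₀ Φ 4 x t ≤ L * wave κ R₀ Φ 3 x t := h4.trans (mul_le_mul_of_nonneg_right hdL k3)
      _ ≤ L * (L * wave κ R₀ Φ 2 x t) := by gcongr
      _ = _ := by ring
  refine ⟨h4', ?_, ?_⟩
  · have hX : (x + 1 - R₀) ≤ (1 + L) * (1 + t) := by nlinarith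
    have hX0 : 0 ≤ x + 1 - R₀ := by linarith
    rw [waveTime, abs_div, abs_of_pos hτ, div_le_iff₀ hτ, abs_le]
    have e1 : (x + 1 - R₀) * wave κ R₀ Φ 3 x t ≤ (1 + L) * (1 + t) * (L * wave κ R₀ Φ 2 x t) := by
      gcongr
    have e2 : (4 - κ) * wave κ R₀ Φ 4 x t ≤ 4 * (L ^ 2 * wave κ R₀ Φ 2 x t) := by
      have : 0 ≤ 4 - κ := by linarith
      gcongr
      linarith
    have e3 : 0 ≤ (4 - κ) * wave κ R₀ Φ 4 x t := mul_nonneg (by linarith) k4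
    have e4 : 0 ≤ (x + 1 - R₀) * wave κ R₀ Φ 3 x t := by positivity
    have e5 : 4 * (L ^ 2 * wave κ R₀ Φ 2 x t) ≤ 4 * (L ^ 2 * wave κ R₀ Φ 2 x t) * (1 + t) := by
      have : 0 ≤ 4 * (L ^ 2 * wave κ R₀ Φ 2 x t) := by positivity
      nlinarith
    have e6 : 0 ≤ L * wave κ R₀ Φ 2 x t * (1 + t) := by positivity
    have e7 : 0 ≤ L ^ 2 * wave κ R₀ Φ 2 x t * (1 + t) := by positivity
    constructor <;> nlinarith
  · have hξ1 : 1 ≤ (x + 1 - R₀) / (1 + t) := by rw [le_div_iff₀ hτ]; linarith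
    have hξ2 : (x + 1 - R₀) / (1 + t) ≤ 1 + L := by rw [div_le_iff₀ hτ]; nlinarith
    have hb := h.le_sq _ ⟨hξ1, hξ2⟩
    have e : (1 + t) ^ (((2 : ℕ) : ℝ) - κ) = (1 + t) ^ (-κ) * (1 + t) ^ 2 := by
      rw [← Real.rpow_add_natCast hτ.ne']
      congr 1
      ring
    unfold wave
    rw [e]
    have hP : 0 < (1 + t) ^ (-κ) := by positivity
    calc (1 + t) ^ (-κ) * (1 + t) ^ 2 * Φ 2 ((x + 1 - R₀) / (1 + t))
        ≤ (1 + t) ^ (-κ) * (1 + t) ^ 2 * (C * ((x + 1 - R₀) / (1 + t) - 1) ^ 2) := by gcongr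
      _ = C * (x - R₀ - t) ^ 2 * (1 + t) ^ (-κ) := by field_simp; ring
      _ ≤ C * L ^ 2 * (1 + t) ^ (-κ) := by gcongr

end Wave

/-! ### The functionals and their derivatives -/

section Functional

variable {γ μ T κ L C R₀ R : ℝ} {ρ u : ℝ → ℝ → ℝ} {Φ : ℕ → ℝ → ℝ}

lemma hasDerivAt_weight {t κ : ℝ} (ht : 0 ≤ t) :
    HasDerivAt (fun s : ℝ => (1 + s) ^ (2 * κ)) (2 * κ / (1 + t) * (1 + t) ^ (2 * κ)) t := by
  have hτ : 0 < 1 + t := by linarith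
  refine (((hasDerivAt_id t).const_add 1).rpow_const (p := 2 * κ) (Or.inl hτ.ne')).congr_deriv ?_
  simp only [id]
  rw [Real.rpow_sub_one hτ.ne']
  ring

lemma contDiffOn_weight (T κ : ℝ) :
    ContDiffOn ℝ 1 (fun z : ℝ × ℝ => (1 + z.2) ^ (2 * κ)) (openStrip T) :=
  ContDiffOn.rpow_const_of_ne (by fun_prop) fun z hz => by
    have := hz.2.1
    linarith

lemma continuousOn_weight (T κ : ℝ) :
    ContinuousOn (fun z : ℝ × ℝ => (1 + z.2) ^ (2 * κ)) (closedStrip T) :=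
  ContinuousOn.rpow_const (by fun_prop) fun z hz => Or.inl (by
    have := hz.2.1
    linarith)

/-- Density of the main functional: the momentum and the density perturbation, tested against the
space and time derivatives of the wave. -/
noncomputable def mainDensity (κ R₀ : ℝ) (Φ : ℕ → ℝ → ℝ) (ρ u : ℝ → ℝ → ℝ) (x t : ℝ) : ℝ :=
  (1 + t) ^ (2 * κ) *
    (ρ x t * u x t * wave κ R₀ Φ 3 x t - (ρ x t - 1) * waveTime κ R₀ Φ x t)

/-- Density of the functional which tests the density perturbation against the wave. -/
noncomputable def waveDensity (κ R₀ : ℝ) (Φ : ℕ → ℝ → ℝ) (ρ : ℝ → ℝ → ℝ) (x t : ℝ) : ℝ :=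
  (1 + t) ^ (2 * κ) * ((ρ x t - 1) * wave κ R₀ Φ 4 x t)

/-- Density of the functional which tests the density perturbation against the time derivative of
the wave. -/
noncomputable def waveTimeDensity (κ R₀ : ℝ) (Φ : ℕ → ℝ → ℝ) (ρ : ℝ → ℝ → ℝ) (x t : ℝ) : ℝ :=
  (1 + t) ^ (2 * κ) * (-(ρ x t - 1) * waveTime κ R₀ Φ x t)

/-- Density of the production of the main functional. It is nonnegative, and this is where the
nonlinearity enters. -/
noncomputable def production (γ κ R₀ : ℝ) (Φ : ℕ → ℝ → ℝ) (ρ u : ℝ → ℝ → ℝ) (x t : ℝ) : ℝ :=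
  (1 + t) ^ (2 * κ) * ((ρ x t * u x t ^ 2 + excess γ (ρ x t)) * wave κ R₀ Φ 2 x t)

lemma SolvesOn.continuousOn_mainDensity (h : SolvesOn γ μ T ρ u) (hΦ : IsProfile κ L C Φ) :
    ContinuousOn (fun z : ℝ × ℝ => mainDensity κ R₀ Φ ρ u z.1 z.2) (closedStrip T) := by
  have h1 := h.continuousOn_density
  have h2 := h.continuousOn_velocity
  have h3 := hΦ.continuousOn_wave (R₀ := R₀) (i := 3) (by norm_num) T
  have h4 := hΦ.continuousOn_waveTime (R₀ := R₀) T
  have h5 := continuousOn_weight T κ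
  unfold mainDensity
  fun_prop

lemma SolvesOn.continuousOn_waveDensity (h : SolvesOn γ μ T ρ u) (hΦ : IsProfile κ L C Φ) :
    ContinuousOn (fun z : ℝ × ℝ => waveDensity κ R₀ Φ ρ z.1 z.2) (closedStrip T) := by
  have h1 := h.continuousOn_density
  have h3 := hΦ.continuousOn_wave (R₀ := R₀) (i := 4) (by norm_num) T
  have h5 := continuousOn_weight T κ
  unfold waveDensity
  fun_prop

lemma SolvesOn.continuousOn_waveTimeDensity (h : SolvesOn γ μ T ρ u) (hΦ : IsProfile κ L C Φ) :
    ContinuousOn (fun z : ℝ × ℝ => waveTimeDensity κ R₀ Φ ρ z.1 z.2) (closedStrip T) := by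
  have h1 := h.continuousOn_density
  have h4 := hΦ.continuousOn_waveTime (R₀ := R₀) T
  have h5 := continuousOn_weight T κ
  unfold waveTimeDensity
  fun_prop

lemma SolvesOn.continuousOn_production (h : SolvesOn γ μ T ρ u) (hΦ : IsProfile κ L C Φ) :
    ContinuousOn (fun z : ℝ × ℝ => production γ κ R₀ Φ ρ u z.1 z.2) (closedStrip T) := by
  have h1 := h.continuousOn_density
  have h2 := h.continuousOn_velocity
  have h3 := hΦ.continuousOn_wave (R₀ := R₀) (i := 2) (by norm_num) T
  have h5 := continuousOn_weight T κ
  have h6 := h.continuousOn_pressure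
  unfold production excess
  fun_prop

/-- The main functional grows by the integral of the production. -/
lemma SolvesOn.hasDerivAt_main (h : SolvesOn γ (2 * κ) T ρ u) (hγ : 1 < γ)
    (hΦ : IsProfile κ L C Φ)
    (hrest : ∀ t ∈ Icc 0 T, ∀ x, R + t < x → ρ x t = 1 ∧ u x t = 0) {t : ℝ} (ht : t ∈ Ioo 0 T) :
    HasDerivAt (fun t => ∫ x in R₀..(R + T), mainDensity κ R₀ Φ ρ u x t)
      (∫ x in R₀..(R + T), production γ κ R₀ Φ ρ u x t) t := by
  have c1 := h.contDiffOn_density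
  have c2 := h.contDiffOn_velocity
  have c3 := hΦ.contDiffOn_wave (R₀ := R₀) (i := 2) (by norm_num) T
  have c4 := hΦ.contDiffOn_waveTime (R₀ := R₀) T
  have c5 := contDiffOn_weight T κ
  have c6 := h.contDiffOn_pressure
  have ht0 := ht.1
  refine hasDerivAt_integral_of_balance (f := mainDensity κ R₀ Φ ρ u)
    (F := fun x t => (1 + t) ^ (2 * κ) * (ρ x t * u x t * waveTime κ R₀ Φ x t
      - (ρ x t * u x t ^ 2 + (pressure γ (ρ x t) - 1 / γ)) * wave κ R₀ Φ 3 x t))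
    (g := production γ κ R₀ Φ ρ u) ?_ (by fun_prop) ?_ ht ?_ ?_
  · unfold mainDensity
    fun_prop
  · intro x t ht ft Fx hft hFx
    have ht0 : 0 ≤ t := ht.1.le
    have hpos := h.density_pos x t (Ioo_subset_Icc_self ht)
    have hρt := hasDerivAt_time c1 (x := x) ht
    have hρx := hasDerivAt_space c1 (x := x) ht
    have hut := hasDerivAt_time c2 (x := x) ht
    have hux := hasDerivAt_space c2 (x := x) ht
    have hmass := h.mass x t ht _ _ _ hρt hρx hux
    have hmom := h.momentum x t ht _ _ _ _ hρt hρx hut hux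
    generalize fderiv ℝ (fun z : ℝ × ℝ => ρ z.1 z.2) (x, t) (0, 1) = ρt at *
    generalize fderiv ℝ (fun z : ℝ × ℝ => ρ z.1 z.2) (x, t) (1, 0) = ρx at *
    generalize fderiv ℝ (fun z : ℝ × ℝ => u z.1 z.2) (x, t) (0, 1) = ut at *
    generalize fderiv ℝ (fun z : ℝ × ℝ => u z.1 z.2) (x, t) (1, 0) = ux at *
    have hp : HasDerivAt (fun y => pressure γ (ρ y t)) (ρ x t ^ (γ - 1) * ρx) x :=
      HasDerivAt.comp (h := fun y => ρ y t) x (hasDerivAt_pressure hγ hpos) hρx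
    have k3x := hΦ.hasDerivAt_wave_space (R₀ := R₀) (i := 2) (by norm_num) (x := x) ht0
    have k3t := hΦ.hasDerivAt_wave_time (R₀ := R₀) (i := 2) (by norm_num) (x := x) ht0
    have ktx := hΦ.hasDerivAt_waveTime_space (R₀ := R₀) (x := x) ht0
    have ktt := hΦ.hasDerivAt_waveTime_time (R₀ := R₀) (x := x) ht0
    have e1 := hft.unique ((hasDerivAt_weight (κ := κ) ht0).fun_mul
      (((hρt.fun_mul hut).fun_mul k3t).fun_sub ((hρt.sub_const 1).fun_mul ktt)))
    have e2 := hFx.unique ((((hρx.fun_mul hux).fun_mul ktx).fun_sub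
      (((hρx.fun_mul (hux.fun_pow 2)).fun_add (hp.sub_const (1 / γ))).fun_mul k3x)).const_mul
        ((1 + t) ^ (2 * κ)))
    rw [e1, e2]
    unfold production excess
    generalize (1 + t) ^ (2 * κ) = W
    generalize ρ x t ^ (γ - 1) = P at *
    generalize pressure γ (ρ x t) = p at *
    generalize ρ x t = r at *
    generalize u x t = v at *
    generalize wave κ R₀ Φ 2 x t = k2 at *
    generalize wave κ R₀ Φ (2 + 1) x t = k3 at *
    generalize waveTime κ R₀ Φ x t = kt at *
    push_cast
    linear_combination W * k3 * hmom - W * kt * hmass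
  · rw [hΦ.waveTime_eq_zero ht0.le (by linarith),
      hΦ.wave_eq_zero (by norm_num) ht0.le (by linarith)]
    ring
  · obtain ⟨hr1, hr2⟩ := hrest t (Ioo_subset_Icc_self ht) (R + T) (by linarith [ht.2])
    rw [hr1, hr2]
    simp [pressure]

/-- Time derivative of the functional of the wave itself. -/
lemma SolvesOn.hasDerivAt_waveFunctional (h : SolvesOn γ (2 * κ) T ρ u)
    (hΦ : IsProfile κ L C Φ)
    (hrest : ∀ t ∈ Icc 0 T, ∀ x, R + t < x → ρ x t = 1 ∧ u x t = 0) {t : ℝ} (ht : t ∈ Ioo 0 T) :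
    HasDerivAt (fun t => ∫ x in R₀..(R + T), waveDensity κ R₀ Φ ρ x t)
      ((∫ x in R₀..(R + T), mainDensity κ R₀ Φ ρ u x t)
        - 2 * (∫ x in R₀..(R + T), waveTimeDensity κ R₀ Φ ρ x t)
        + 2 * κ / (1 + t) * ∫ x in R₀..(R + T), waveDensity κ R₀ Φ ρ x t) t := by
  have c1 := h.contDiffOn_density
  have c2 := h.contDiffOn_velocity
  have c3 := hΦ.contDiffOn_wave (R₀ := R₀) (i := 3) (by norm_num) T
  have c5 := contDiffOn_weight T κ
  have ht0 := ht.1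
  have htI := Ioo_subset_Icc_self ht
  have hmain := hasDerivAt_integral_of_balance (f := waveDensity κ R₀ Φ ρ) (a := R₀) (b := R + T)
    (F := fun x t => (1 + t) ^ (2 * κ) * (-(ρ x t * u x t) * wave κ R₀ Φ 4 x t))
    (g := fun x t => mainDensity κ R₀ Φ ρ u x t - 2 * waveTimeDensity κ R₀ Φ ρ x t
      + 2 * κ / (1 + t) * waveDensity κ R₀ Φ ρ x t)
    (by unfold waveDensity; fun_prop) (by fun_prop) ?_ ht ?_ ?_
  · refine hmain.congr_deriv ?_
    have i1 := (continuous_slice (h.continuousOn_mainDensity (R₀ := R₀) hΦ) htI).intervalIntegrable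
      (μ := volume) R₀ (R + T)
    have i2 := (continuous_slice (h.continuousOn_waveTimeDensity (R₀ := R₀) hΦ)
      htI).intervalIntegrable (μ := volume) R₀ (R + T)
    have i3 := (continuous_slice (h.continuousOn_waveDensity (R₀ := R₀) hΦ) htI).intervalIntegrable
      (μ := volume) R₀ (R + T)
    rw [intervalIntegral.integral_add (i1.sub (i2.const_mul 2)) (i3.const_mul _),
      intervalIntegral.integral_sub i1 (i2.const_mul 2), intervalIntegral.integral_const_mul,
      intervalIntegral.integral_const_mul]
  · intro x t ht ft Fx hft hFx
    have ht0 : 0 ≤ t := ht.1.le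
    have hρt := hasDerivAt_time c1 (x := x) ht
    have hρx := hasDerivAt_space c1 (x := x) ht
    have hux := hasDerivAt_space c2 (x := x) ht
    have hmass := h.mass x t ht _ _ _ hρt hρx hux
    generalize fderiv ℝ (fun z : ℝ × ℝ => ρ z.1 z.2) (x, t) (0, 1) = ρt at *
    generalize fderiv ℝ (fun z : ℝ × ℝ => ρ z.1 z.2) (x, t) (1, 0) = ρx at *
    generalize fderiv ℝ (fun z : ℝ × ℝ => u z.1 z.2) (x, t) (1, 0) = ux at *
    have k4x := hΦ.hasDerivAt_wave_space (R₀ := R₀) (i := 3) (by norm_num) (x := x) ht0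
    have k4t := hΦ.hasDerivAt_wave_time (R₀ := R₀) (i := 3) (by norm_num) (x := x) ht0
    have k4t' : HasDerivAt (fun s => wave κ R₀ Φ 4 x s) (waveTime κ R₀ Φ x t) t :=
      k4t.congr_deriv (by rw [waveTime]; push_cast; ring_nf)
    have e1 := hft.unique ((hasDerivAt_weight (κ := κ) ht0).fun_mul
      ((hρt.sub_const 1).fun_mul k4t'))
    have e2 := hFx.unique ((((hρx.fun_mul hux).fun_neg).fun_mul k4x).const_mul ((1 + t) ^ (2 * κ)))
    rw [e1, e2]
    unfold mainDensity waveTimeDensity waveDensity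
    generalize (1 + t) ^ (2 * κ) = W
    generalize ρ x t = r at *
    generalize u x t = v at *
    generalize wave κ R₀ Φ 4 x t = k4 at *
    generalize wave κ R₀ Φ 3 x t = k3 at *
    generalize waveTime κ R₀ Φ x t = kt at *
    linear_combination W * k4 * hmass
  · rw [hΦ.wave_eq_zero (by norm_num) ht0.le (by linarith)]
    ring
  · obtain ⟨hr1, hr2⟩ := hrest t htI (R + T) (by linarith [ht.2])
    rw [hr1, hr2]
    simp

lemma integral_eq_of_eq_zero {f : ℝ → ℝ} (hf : Continuous f) {a a' b' b : ℝ} (h1 : a ≤ a')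
    (h3 : b' ≤ b) (ha : ∀ x ≤ a', f x = 0) (hb : ∀ x, b' < x → f x = 0) :
    ∫ x in a..b, f x = ∫ x in a'..b', f x := by
  rw [← intervalIntegral.integral_add_adjacent_intervals (hf.intervalIntegrable a a')
    (hf.intervalIntegrable a' b), ← intervalIntegral.integral_add_adjacent_intervals
    (hf.intervalIntegrable a' b') (hf.intervalIntegrable b' b)]
  have e1 : ∫ x in a..a', f x = 0 := by
    rw [intervalIntegral.integral_congr (g := fun _ => 0)]
    · simp
    · intro x hx
      rw [uIcc_of_le h1] at hx
      exact ha x hx.2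
  have e2 : ∫ x in b'..b, f x = 0 := by
    rw [intervalIntegral.integral_congr_ae (g := fun _ => 0)]
    · simp
    · refine Eventually.of_forall fun x hx => ?_
      rw [uIoc_of_le h3] at hx
      exact hb x hx.1
  rw [e1, e2]
  ring

/-- The production is nonnegative and, by the affine lower bounds for the excess, it dominates every
multiple of the two linear functionals up to a superlinear defect. -/
lemma SolvesOn.le_integral_production {q : ℕ} {c a : ℝ} (h : SolvesOn γ μ T ρ u) (hγ : 1 < γ)
    (hκ0 : 0 ≤ κ) (hκ1 : κ ≤ 1) (hR : R₀ < R) (hC : 0 ≤ C)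
    (hΦ : IsProfile κ (R - R₀) C Φ) (hq : 2 ≤ q) (hc : 0 < c)
    (ha : a = 6 * (R - R₀) ^ 2 + (R - R₀))
    (hexc : ∀ θ ρ : ℝ, 0 ≤ θ → 0 < ρ → θ * |ρ - 1| - c * (θ ^ 2 + θ ^ q) ≤ excess γ ρ)
    (hrest : ∀ t ∈ Icc 0 T, ∀ x, R + t < x → ρ x t = 1 ∧ u x t = 0) {t : ℝ} (ht : t ∈ Icc 0 T) :
    0 ≤ (∫ x in R₀..(R + T), production γ κ R₀ Φ ρ u x t) ∧ ∀ θ : ℝ, 0 ≤ θ →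
      (1 + t) ^ (-κ) * (θ * (|∫ x in R₀..(R + T), waveDensity κ R₀ Φ ρ x t|
        + |∫ x in R₀..(R + T), waveTimeDensity κ R₀ Φ ρ x t|)
        - c * C * (R - R₀) ^ 3 * (a ^ 2 + a ^ q) * (θ ^ 2 + θ ^ q))
      ≤ ∫ x in R₀..(R + T), production γ κ R₀ Φ ρ u x t := by
  have ht0 := ht.1
  have hτ : 0 < 1 + t := by linarith
  set L := R - R₀ with hL
  have hL0 : 0 < L := by linarith
  have ha0 : 0 ≤ a := by rw [ha]; positivity
  have cA := continuous_slice (h.continuousOn_waveDensity (R₀ := R₀) hΦ) ht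
  have cB := continuous_slice (h.continuousOn_waveTimeDensity (R₀ := R₀) hΦ) ht
  have cP := continuous_slice (h.continuousOn_production (R₀ := R₀) hΦ) ht
  have hPnn : ∀ x, 0 ≤ production γ κ R₀ Φ ρ u x t := fun x => by
    have h1 := h.density_pos x t ht
    have h2 := excess_nonneg hγ h1
    have h3 := hΦ.wave_nonneg (R₀ := R₀) (i := 2) (by norm_num) (x := x) ht0
    unfold production
    positivity
  refine ⟨intervalIntegral.integral_nonneg (by linarith [ht.2]) fun x _ => hPnn x, ?_⟩
  intro θ hθ
  -- all integrands are supported in the strip `R₀ + t ≤ x ≤ R + t`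
  rw [integral_eq_of_eq_zero (a' := R₀ + t) (b' := R + t) cA (by linarith) (by linarith [ht.2])
      (fun x hx => by
        simp only [waveDensity, hΦ.wave_eq_zero (i := 4) (by norm_num) ht0 hx]
        ring)
      (fun x hx => by simp [waveDensity, (hrest t ht x hx).1]),
    integral_eq_of_eq_zero (a' := R₀ + t) (b' := R + t) cB (by linarith) (by linarith [ht.2])
      (fun x hx => by
        simp only [waveTimeDensity, hΦ.waveTime_eq_zero ht0 hx]
        ring)
      (fun x hx => by simp [waveTimeDensity, (hrest t ht x hx).1]),
    integral_eq_of_eq_zero (a' := R₀ + t) (b' := R + t) cP (by linarith) (by linarith [ht.2])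
      (fun x hx => by
        simp only [production, hΦ.wave_eq_zero (i := 2) (by norm_num) ht0 hx]
        ring)
      (fun x hx => by simp [production, (hrest t ht x hx).1, (hrest t ht x hx).2])]
  simp only
  have hle : R₀ + t ≤ R + t := by linarith
  set W := (1 + t) ^ (2 * κ) with hW
  set V := (1 + t) ^ (-κ) with hV
  have hV0 : 0 < V := by positivity
  have hW0 : 0 < W := by positivity
  have hV1 : V ≤ 1 := Real.rpow_le_one_of_one_le_of_nonpos (by linarith) (by linarith)
  have hWV : W * V ^ 2 = 1 := by
    rw [hW, hV, ← Real.rpow_natCast, ← Real.rpow_mul hτ.le, ← Real.rpow_add hτ]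
    convert Real.rpow_zero (1 + t) using 2
    push_cast
    ring
  set K₀ := c * C * L ^ 2 * (a ^ 2 + a ^ q) * (θ ^ 2 + θ ^ q) with hK₀
  have hpt : ∀ x ∈ Icc (R₀ + t) (R + t),
      V * (θ * (|waveDensity κ R₀ Φ ρ x t| + |waveTimeDensity κ R₀ Φ ρ x t|) - K₀)
      ≤ production γ κ R₀ Φ ρ u x t := by
    intro x hx
    obtain ⟨b1, b2, b3⟩ := hΦ.wave_bounds hκ0 hκ1 hL0.le hC ht0 hx.1 (by linarith [hx.2])
    have hpos := h.density_pos x t ht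
    have k2 := hΦ.wave_nonneg (R₀ := R₀) (i := 2) (by norm_num) (x := x) ht0
    have k4 := hΦ.wave_nonneg (R₀ := R₀) (i := 4) (by norm_num) (x := x) ht0
    have he := hexc (a * θ * V) (ρ x t) (by positivity) hpos
    unfold waveDensity waveTimeDensity production
    rw [← hW, ← hV] at *
    generalize wave κ R₀ Φ 2 x t = k at *
    generalize wave κ R₀ Φ 4 x t = k' at *
    generalize waveTime κ R₀ Φ x t = kt at *
    rw [abs_mul, abs_mul, abs_mul, abs_mul, abs_neg, abs_of_pos hW0, abs_of_nonneg k4]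
    have hw0 : 0 ≤ |ρ x t - 1| := abs_nonneg _
    generalize |ρ x t - 1| = w at *
    have hw : 0 ≤ ρ x t * u x t ^ 2 := by positivity
    have hdef : W * (c * ((a * θ * V) ^ 2 + (a * θ * V) ^ q)) * k ≤ V * K₀ := by
      have h1 : (a * θ * V) ^ 2 + (a * θ * V) ^ q ≤ (a ^ 2 + a ^ q) * (θ ^ 2 + θ ^ q) * V ^ 2 := by
        have hVq : V ^ q ≤ V ^ 2 := pow_le_pow_of_le_one hV0.le hV1 hq
        rw [mul_pow, mul_pow, mul_pow, mul_pow]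
        have e1 : a ^ q * θ ^ q * V ^ q ≤ a ^ q * θ ^ q * V ^ 2 := by gcongr
        have e2 : 0 ≤ (a ^ 2 * θ ^ q + a ^ q * θ ^ 2) * V ^ 2 := by positivity
        linarith
      calc W * (c * ((a * θ * V) ^ 2 + (a * θ * V) ^ q)) * k
          ≤ W * (c * ((a ^ 2 + a ^ q) * (θ ^ 2 + θ ^ q) * V ^ 2)) * (C * L ^ 2 * V) := by gcongr
        _ = (W * V ^ 2) * (V * K₀) := by rw [hK₀]; ring
        _ = V * K₀ := by rw [hWV, one_mul]
    have hsum : k' + |kt| ≤ a * k := by rw [ha]; linarith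
    have h1 : V * θ * W * w * (k' + |kt|) ≤ V * θ * W * w * (a * k) := by gcongr
    have h2 : W * k * (a * θ * V * w - c * ((a * θ * V) ^ 2 + (a * θ * V) ^ q))
        ≤ W * k * excess γ (ρ x t) := by gcongr
    have h3 : 0 ≤ W * (ρ x t * u x t ^ 2) * k := by positivity
    linarith
  have iA : IntervalIntegrable (fun x => |waveDensity κ R₀ Φ ρ x t|) volume (R₀ + t) (R + t) :=
    cA.abs.intervalIntegrable _ _
  have iB : IntervalIntegrable (fun x => |waveTimeDensity κ R₀ Φ ρ x t|) volume (R₀ + t) (R + t) :=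
    cB.abs.intervalIntegrable _ _
  have hmono := intervalIntegral.integral_mono_on hle
    ((((iA.add iB).const_mul θ).sub (intervalIntegrable_const (c := K₀))).const_mul V)
    (cP.intervalIntegrable _ _) hpt
  rw [intervalIntegral.integral_const_mul, intervalIntegral.integral_sub
    ((iA.add iB).const_mul θ) intervalIntegrable_const, intervalIntegral.integral_const_mul,
    intervalIntegral.integral_add iA iB, intervalIntegral.integral_const] at hmono
  refine le_trans ?_ hmono
  have hA := intervalIntegral.abs_integral_le_integral_abs
    (f := fun x => waveDensity κ R₀ Φ ρ x t) (μ := volume) hle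
  have hB := intervalIntegral.abs_integral_le_integral_abs
    (f := fun x => waveTimeDensity κ R₀ Φ ρ x t) (μ := volume) hle
  have eK : (R + t - (R₀ + t)) • K₀ = c * C * L ^ 3 * (a ^ 2 + a ^ q) * (θ ^ 2 + θ ^ q) := by
    rw [smul_eq_mul, hK₀, hL]
    ring
  rw [eK]
  gcongr

end Functional

/-! ### Initial values and the lifespan -/

section Tails

variable {g : ℝ → ℝ}

lemma hasDerivAt_tail (hg : Continuous g) (b r : ℝ) :
    HasDerivAt (fun r => ∫ x in r..b, g x) (-g r) r :=
  intervalIntegral.integral_hasDerivAt_left (hg.intervalIntegrable _ _)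
    hg.aestronglyMeasurable.stronglyMeasurableAtFilter hg.continuousAt

lemma hasDerivAt_tail_mul (hg : Continuous g) (b r : ℝ) :
    HasDerivAt (fun r => ∫ x in r..b, (x - r) * g x) (-∫ x in r..b, g x) r := by
  have hxg : Continuous fun x => x * g x := by fun_prop
  have e : (fun r => ∫ x in r..b, (x - r) * g x) =
      fun r => (∫ x in r..b, x * g x) - r * ∫ x in r..b, g x := by
    funext r
    rw [← intervalIntegral.integral_const_mul, ← intervalIntegral.integral_sub
      (hxg.intervalIntegrable _ _) ((hg.intervalIntegrable _ _).const_mul r)]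
    exact intervalIntegral.integral_congr fun x _ => by ring
  rw [e]
  refine ((hasDerivAt_tail hxg b r).fun_sub
    ((hasDerivAt_id r).fun_mul (hasDerivAt_tail hg b r))).congr_deriv ?_
  simp only [id]
  ring

lemma hasDerivAt_tail_sq_mul (hg : Continuous g) (b r : ℝ) :
    HasDerivAt (fun r => ∫ x in r..b, (x - r) ^ 2 * g x) (-(2 * ∫ x in r..b, (x - r) * g x)) r := by
  have hxg : Continuous fun x => x * g x := by fun_prop
  have e : (fun r => ∫ x in r..b, (x - r) ^ 2 * g x) =
      fun r => (∫ x in r..b, (x - r) * (x * g x)) - r * ∫ x in r..b, (x - r) * g x := by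
    funext r
    have c1 : Continuous fun x => (x - r) * (x * g x) := by fun_prop
    have c2 : Continuous fun x => (x - r) * g x := by fun_prop
    rw [← intervalIntegral.integral_const_mul, ← intervalIntegral.integral_sub
      (c1.intervalIntegrable _ _) ((c2.intervalIntegrable _ _).const_mul r)]
    exact intervalIntegral.integral_congr fun x _ => by ring
  rw [e]
  refine ((hasDerivAt_tail_mul hxg b r).fun_sub
    ((hasDerivAt_id r).fun_mul (hasDerivAt_tail_mul hg b r))).congr_deriv ?_
  have e2 : ∫ x in r..b, (x - r) * g x = (∫ x in r..b, x * g x) - r * ∫ x in r..b, g x := by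
    rw [← intervalIntegral.integral_const_mul, ← intervalIntegral.integral_sub
      (hxg.intervalIntegrable _ _) ((hg.intervalIntegrable _ _).const_mul r)]
    exact intervalIntegral.integral_congr fun x _ => by ring
  simp only [id]
  rw [e2]
  ring

variable {κ L C a b : ℝ} {Φ : ℕ → ℝ → ℝ}

lemma IsProfile.hasDerivAt_shift (h : IsProfile κ L C Φ) {i : ℕ} (hi : 1 ≤ i) (a x : ℝ) :
    HasDerivAt (fun y => Φ (i + 1) (y + 1 - a)) (Φ i (x + 1 - a)) x := by
  have := (h.hasDerivAt i hi (x + 1 - a)).comp x (((hasDerivAt_id x).add_const 1).sub_const a)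
  simpa [Function.comp_def] using this

lemma IsProfile.hasDerivAt_shift_one (h : IsProfile κ L C Φ) {a x : ℝ} (hx : a < x) :
    HasDerivAt (fun y => Φ 1 (y + 1 - a)) (Φ 0 (x + 1 - a)) x := by
  have := (h.hasDerivAt_one (x + 1 - a) (by linarith)).comp x
    (((hasDerivAt_id x).add_const 1).sub_const a)
  simpa [Function.comp_def] using this

/-- The weight of the initial momentum, after two integrations by parts. -/
lemma IsProfile.integral_mul_three (h : IsProfile κ L C Φ) (hg : Continuous g) :
    ∫ x in a..b, g x * Φ 3 (x + 1 - a) =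
      ∫ r in a..b, (∫ x in r..b, (x - r) * g x) * Φ 1 (r + 1 - a) := by
  have hc : ∀ i, 1 ≤ i → Continuous fun x => Φ i (x + 1 - a) := fun i hi =>
    (h.continuous i hi).comp (by fun_prop)
  have d1 := hasDerivAt_tail hg b
  have d2 := hasDerivAt_tail_mul hg b
  have c2 : Continuous fun r => ∫ x in r..b, (x - r) * g x :=
    continuous_iff_continuousAt.2 fun r => (d2 r).continuousAt
  have i1 : IntervalIntegrable (fun x => g x * Φ 3 (x + 1 - a)) volume a b :=
    (hg.mul (hc 3 (by norm_num))).intervalIntegrable _ _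
  have i2 : IntervalIntegrable (fun r => (∫ x in r..b, (x - r) * g x) * Φ 1 (r + 1 - a))
      volume a b := (c2.mul (hc 1 le_rfl)).intervalIntegrable _ _
  have hd : ∀ x ∈ uIcc a b, HasDerivAt (fun r => -((∫ x in r..b, g x) * Φ 3 (r + 1 - a))
      - (∫ x in r..b, (x - r) * g x) * Φ 2 (r + 1 - a))
      (g x * Φ 3 (x + 1 - a) - (∫ y in x..b, (y - x) * g y) * Φ 1 (x + 1 - a)) x := by
    intro x _
    refine ((((d1 x).fun_mul (h.hasDerivAt_shift (i := 2) (by norm_num) a x)).fun_neg).fun_sub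
      ((d2 x).fun_mul (h.hasDerivAt_shift (i := 1) le_rfl a x))).congr_deriv ?_
    ring
  have hI := intervalIntegral.integral_eq_sub_of_hasDerivAt hd (i1.sub i2)
  rw [intervalIntegral.integral_sub i1 i2] at hI
  have z : ∀ i, 1 ≤ i → Φ i (a + 1 - a) = 0 := fun i hi => h.eq_zero i hi _ (by linarith)
  simp only [z 3 (by norm_num), z 2 (by norm_num), intervalIntegral.integral_same] at hI
  linarith

/-- The weight of the initial density, after three integrations by parts. -/
lemma IsProfile.integral_mul_time (h : IsProfile κ L C Φ) (hg : Continuous g) (hab : a ≤ b) :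
    (∫ x in a..b, g x * ((x + 1 - a) * Φ 3 (x + 1 - a) - (4 - κ) * Φ 4 (x + 1 - a)) =
      1 / 2 * ∫ r in a..b, (∫ x in r..b, (x - r) ^ 2 * g x) *
        ((r + 1 - a) * Φ 0 (r + 1 - a) - (1 - κ) * Φ 1 (r + 1 - a))) ∧
    IntervalIntegrable (fun r => (∫ x in r..b, (x - r) ^ 2 * g x) *
        ((r + 1 - a) * Φ 0 (r + 1 - a) - (1 - κ) * Φ 1 (r + 1 - a))) volume a b := by
  have hΦ1 := h.continuous 1 le_rfl
  have hΦ2 := h.continuous 2 (by norm_num)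
  have hΦ3 := h.continuous 3 (by norm_num)
  have hΦ4 := h.continuous 4 (by norm_num)
  have hc0 : ContinuousOn (fun x => Φ 0 (x + 1 - a)) (Icc a b) :=
    h.continuousOn_zero.comp (by fun_prop) fun x hx => by
      have := hx.1
      simp only [mem_Ici]
      linarith
  have d1 := hasDerivAt_tail hg b
  have d2 := hasDerivAt_tail_mul hg b
  have d3 := hasDerivAt_tail_sq_mul hg b
  have c1 : Continuous fun r => ∫ x in r..b, g x :=
    continuous_iff_continuousAt.2 fun r => (d1 r).continuousAt
  have c2 : Continuous fun r => ∫ x in r..b, (x - r) * g x :=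
    continuous_iff_continuousAt.2 fun r => (d2 r).continuousAt
  have c3 : Continuous fun r => ∫ x in r..b, (x - r) ^ 2 * g x :=
    continuous_iff_continuousAt.2 fun r => (d3 r).continuousAt
  have i1 : IntervalIntegrable (fun x => g x * ((x + 1 - a) * Φ 3 (x + 1 - a)
      - (4 - κ) * Φ 4 (x + 1 - a))) volume a b :=
    Continuous.intervalIntegrable (by fun_prop) _ _
  have i2 : IntervalIntegrable (fun r => (∫ x in r..b, (x - r) ^ 2 * g x) *
        ((r + 1 - a) * Φ 0 (r + 1 - a) - (1 - κ) * Φ 1 (r + 1 - a))) volume a b := by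
    refine ContinuousOn.intervalIntegrable ?_
    rw [uIcc_of_le hab]
    refine c3.continuousOn.mul (ContinuousOn.sub (ContinuousOn.mul ?_ hc0) ?_)
    · fun_prop
    · fun_prop
  refine ⟨?_, i2⟩
  have hX : ∀ x : ℝ, HasDerivAt (fun y : ℝ => y + 1 - a) 1 x := fun x =>
    ((hasDerivAt_id x).add_const 1).sub_const a
  have hd : ∀ x ∈ Ioo a b, HasDerivAt (fun r =>
      -((∫ x in r..b, g x) * ((r + 1 - a) * Φ 3 (r + 1 - a) - (4 - κ) * Φ 4 (r + 1 - a)))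
      - (∫ x in r..b, (x - r) * g x) * ((r + 1 - a) * Φ 2 (r + 1 - a) - (3 - κ) * Φ 3 (r + 1 - a))
      - 1 / 2 * ((∫ x in r..b, (x - r) ^ 2 * g x)
        * ((r + 1 - a) * Φ 1 (r + 1 - a) - (2 - κ) * Φ 2 (r + 1 - a))))
      (g x * ((x + 1 - a) * Φ 3 (x + 1 - a) - (4 - κ) * Φ 4 (x + 1 - a))
        - 1 / 2 * ((∫ y in x..b, (y - x) ^ 2 * g y) *
        ((x + 1 - a) * Φ 0 (x + 1 - a) - (1 - κ) * Φ 1 (x + 1 - a)))) x := by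
    intro x hx
    have p4 := h.hasDerivAt_shift (i := 3) (by norm_num) a x
    have p3 := h.hasDerivAt_shift (i := 2) (by norm_num) a x
    have p2 := h.hasDerivAt_shift (i := 1) le_rfl a x
    have p1 := h.hasDerivAt_shift_one hx.1
    refine ((((d1 x).fun_mul (((hX x).fun_mul p3).fun_sub (p4.const_mul (4 - κ)))).fun_neg.fun_sub
      ((d2 x).fun_mul (((hX x).fun_mul p2).fun_sub (p3.const_mul (3 - κ))))).fun_sub
      (((d3 x).fun_mul (((hX x).fun_mul p1).fun_sub (p2.const_mul (2 - κ)))).const_mul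
        (1 / 2))).congr_deriv ?_
    ring
  have w : ∀ i, 1 ≤ i → Continuous fun r : ℝ =>
      (r + 1 - a) * Φ i (r + 1 - a) - ((i + 1 : ℕ) - κ) * Φ (i + 1) (r + 1 - a) := fun i hi => by
    have hi1 := h.continuous i hi
    have hi2 := h.continuous (i + 1) (by omega)
    fun_prop
  have w3 := w 3 (by norm_num)
  have w2 := w 2 (by norm_num)
  have w1 := w 1 le_rfl
  norm_num at w3 w2 w1
  have hcont := ((c1.mul w3).neg.sub (c2.mul w2)).sub ((c3.mul w1).const_mul (1 / 2))
  have hI := intervalIntegral.integral_eq_sub_of_hasDerivAt_of_le hab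
    (by exact hcont.continuousOn) hd (i1.sub (i2.const_mul (1 / 2)))
  rw [intervalIntegral.integral_sub i1 (i2.const_mul _), intervalIntegral.integral_const_mul] at hI
  have z : ∀ i, 1 ≤ i → Φ i (a + 1 - a) = 0 := fun i hi => h.eq_zero i hi _ (by linarith)
  simp only [z 4 (by norm_num), z 3 (by norm_num), z 2 (by norm_num), z 1 le_rfl,
    intervalIntegral.integral_same] at hI
  linarith

end Tails

lemma eq_zero_of_tsupport_subset {f : ℝ → ℝ} {R : ℝ} (hf : tsupport f ⊆ Icc (-R) R) {x : ℝ}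
    (hx : R < x) : f x = 0 :=
  image_eq_zero_of_notMem_tsupport fun hmem => by
    have := (hf hmem).2
    linarith

lemma setIntegral_Ioi_eq {f : ℝ → ℝ} {r R : ℝ} (hr : r ≤ R) (hf : ∀ x, R < x → f x = 0) :
    ∫ x in Ioi r, f x = ∫ x in r..R, f x := by
  rw [intervalIntegral.integral_of_le hr]
  refine setIntegral_eq_of_subset_of_forall_sdiff_eq_zero measurableSet_Ioi
    Ioc_subset_Ioi_self fun x hx => hf x ?_
  by_contra hcon
  exact hx.2 ⟨hx.1, not_lt.1 hcon⟩

lemma q0_eq {ρ₀ : ℝ → ℝ} {r R : ℝ} (hr : r ≤ R) (h : ∀ x, R < x → ρ₀ x = 0) :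
    q0 ρ₀ r = ∫ x in r..R, (x - r) ^ 2 * ρ₀ x :=
  setIntegral_Ioi_eq hr fun x hx => by rw [h x hx, mul_zero]

lemma q1_eq {ε : ℝ} {ρ₀ u₀ : ℝ → ℝ} {r R : ℝ} (hr : r ≤ R) (h : ∀ x, R < x → u₀ x = 0) :
    q1 ε ρ₀ u₀ r = 2 * ∫ x in r..R, (x - r) * ((1 + ε * ρ₀ x) * u₀ x) := by
  rw [q1, setIntegral_Ioi_eq hr fun x hx => by rw [h x hx, mul_zero, mul_zero]]

lemma B0_eq {ρ₀ : ℝ → ℝ} {R₀ R : ℝ} (hR : R₀ ≤ R) (h : ∀ x, R < x → ρ₀ x = 0) :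
    B0 R₀ R ρ₀ = 1 / 2 * ∫ r in R₀..R, ∫ x in r..R, (x - r) ^ 2 * ρ₀ x := by
  rw [B0]
  congr 1
  refine intervalIntegral.integral_congr fun r hr => ?_
  rw [uIcc_of_le hR] at hr
  exact q0_eq hr.2 h

lemma B0_pos {ρ₀ : ℝ → ℝ} {R₀ R : ℝ} (hR : R₀ < R) (hc : Continuous ρ₀)
    (h : ∀ x, R < x → ρ₀ x = 0) (hq : ∀ r ∈ Ioo R₀ R, 0 < q0 ρ₀ r) : 0 < B0 R₀ R ρ₀ := by
  have hcont : Continuous fun r => ∫ x in r..R, (x - r) ^ 2 * ρ₀ x :=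
    continuous_iff_continuousAt.2 fun r => (hasDerivAt_tail_sq_mul hc R r).continuousAt
  have hpos : 0 < ∫ r in R₀..R, ∫ x in r..R, (x - r) ^ 2 * ρ₀ x := by
    refine intervalIntegral.intervalIntegral_pos_of_pos_on (hcont.intervalIntegrable _ _) ?_ hR
    intro r hr
    rw [← q0_eq hr.2.le h]
    exact hq r hr
  rw [B0_eq hR.le h]
  linarith

/-- At time `0` the main functional is at least `ε B₀ / 2`: by parts, it is an integral of `q⁰` and
`q¹` against nonnegative weights, and the weight of `q⁰` is bounded below. -/
lemma le_main_zero {κ C L R₀ R T ε : ℝ} {Φ : ℕ → ℝ → ℝ} {ρ₀ u₀ : ℝ → ℝ} {ρ u : ℝ → ℝ → ℝ}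
    (hΦ : IsProfile κ L C Φ) (hR : R₀ < R) (hT : 0 ≤ T) (hε : 0 < ε)
    (hρc : Continuous ρ₀) (huc : Continuous u₀)
    (hρ0 : ∀ x, R < x → ρ₀ x = 0) (hu0 : ∀ x, R < x → u₀ x = 0)
    (hρ : ∀ x, ρ x 0 = 1 + ε * ρ₀ x) (hu : ∀ x, u x 0 = ε * u₀ x)
    (hq0 : ∀ r ∈ Ioo R₀ R, 0 < q0 ρ₀ r) (hq1 : ∀ r ∈ Ioo R₀ R, 0 ≤ q1 ε ρ₀ u₀ r) :
    ε * B0 R₀ R ρ₀ / 2 ≤ ∫ x in R₀..(R + T), mainDensity κ R₀ Φ ρ u x 0 := by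
  have hc3 := hΦ.continuous 3 (by norm_num)
  have hc4 := hΦ.continuous 4 (by norm_num)
  have hmc : Continuous fun x => (1 + ε * ρ₀ x) * u₀ x := by fun_prop
  have hdens : ∀ x, mainDensity κ R₀ Φ ρ u x 0 =
      ε * (((1 + ε * ρ₀ x) * u₀ x) * Φ 3 (x + 1 - R₀)) +
      ε * (ρ₀ x * ((x + 1 - R₀) * Φ 3 (x + 1 - R₀) - (4 - κ) * Φ 4 (x + 1 - R₀))) := by
    intro x
    simp only [mainDensity, waveTime, wave, hρ, hu, add_zero, Real.one_rpow, div_one]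
    ring
  have i1 : IntervalIntegrable (fun x => ((1 + ε * ρ₀ x) * u₀ x) * Φ 3 (x + 1 - R₀)) volume R₀ R :=
    Continuous.intervalIntegrable (by fun_prop) _ _
  have i2 : IntervalIntegrable (fun x => ρ₀ x * ((x + 1 - R₀) * Φ 3 (x + 1 - R₀)
      - (4 - κ) * Φ 4 (x + 1 - R₀))) volume R₀ R :=
    Continuous.intervalIntegrable (by fun_prop) _ _
  simp_rw [hdens]
  rw [integral_eq_of_eq_zero (a' := R₀) (b' := R) (by fun_prop) le_rfl (by linarith)
    (fun x hx => by
      simp [hΦ.eq_zero 3 (by norm_num) (x + 1 - R₀) (by linarith),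
        hΦ.eq_zero 4 (by norm_num) (x + 1 - R₀) (by linarith)])
    (fun x hx => by simp [hρ0 x hx, hu0 x hx]),
    intervalIntegral.integral_add (i1.const_mul ε) (i2.const_mul ε),
    intervalIntegral.integral_const_mul, intervalIntegral.integral_const_mul,
    hΦ.integral_mul_three hmc]
  obtain ⟨e2, i3⟩ := hΦ.integral_mul_time hρc hR.le
  rw [e2]
  have h1 : 0 ≤ ∫ r in R₀..R,
      (∫ x in r..R, (x - r) * ((1 + ε * ρ₀ x) * u₀ x)) * Φ 1 (r + 1 - R₀) := by
    rw [intervalIntegral.integral_of_le hR.le, integral_Ioc_eq_integral_Ioo]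
    refine setIntegral_nonneg measurableSet_Ioo fun r hr => mul_nonneg ?_ (hΦ.nonneg 1 le_rfl _)
    have := hq1 r hr
    rw [q1_eq hr.2.le hu0] at this
    linarith
  have hcont : Continuous fun r => ∫ x in r..R, (x - r) ^ 2 * ρ₀ x :=
    continuous_iff_continuousAt.2 fun r => (hasDerivAt_tail_sq_mul hρc R r).continuousAt
  have h2 : ∫ r in R₀..R, 1 / 2 * (∫ x in r..R, (x - r) ^ 2 * ρ₀ x) ≤
      ∫ r in R₀..R, (∫ x in r..R, (x - r) ^ 2 * ρ₀ x) *
        ((r + 1 - R₀) * Φ 0 (r + 1 - R₀) - (1 - κ) * Φ 1 (r + 1 - R₀)) := by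
    refine intervalIntegral.integral_mono_on_of_le_Ioo hR.le
      ((hcont.intervalIntegrable _ _).const_mul _) i3 fun r hr => ?_
    have hp := hq0 r hr
    rw [q0_eq hr.2.le hρ0] at hp
    have hb := hΦ.half_le (r + 1 - R₀) (by linarith [hr.1])
    nlinarith
  rw [intervalIntegral.integral_const_mul] at h2
  rw [B0_eq hR.le hρ0]
  nlinarith

/-- The lifespan bound for every `γ > 1`: the logarithm of the lifespan is at most a constant times
`1 / min 1 (ε B₀ / 2)`. -/
lemma exists_lifespan_bound {γ κ R₀ R : ℝ} (hγ : 1 < γ) (hκ0 : 0 ≤ κ) (hκ1 : κ ≤ 1) (hR : R₀ < R) :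
    ∃ C : ℝ, 0 < C ∧ ∀ ρ₀ u₀ : ℝ → ℝ, Continuous ρ₀ → Continuous u₀ →
      tsupport ρ₀ ⊆ Icc (-R) R → tsupport u₀ ⊆ Icc (-R) R → ∀ ε : ℝ, 0 < ε →
      (∀ r ∈ Ioo R₀ R, 0 < q0 ρ₀ r) → (∀ r ∈ Ioo R₀ R, 0 ≤ q1 ε ρ₀ u₀ r) →
      ∀ (T : ℝ≥0∞) (ρ u : ℝ → ℝ → ℝ), IsC1Solution γ (2 * κ) ε ρ₀ u₀ T ρ u →
      ∀ T₁ : ℝ, 0 ≤ T₁ → ENNReal.ofReal T₁ < T →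
        Real.log (1 + T₁) ≤ C / min 1 (ε * B0 R₀ R ρ₀ / 2) := by
  obtain ⟨q, c, hq, hc, hexc⟩ := exists_mul_abs_sub_le_excess hγ
  obtain ⟨C, Φ, hC, hΦ⟩ := exists_isProfile hκ0 hκ1 (R - R₀)
  set a := 6 * (R - R₀) ^ 2 + (R - R₀) with ha
  have hL : 0 < R - R₀ := by linarith
  obtain ⟨C', hC', hlog⟩ := log_lifespan_le hq
    (K := c * C * (R - R₀) ^ 3 * (a ^ 2 + a ^ q)) (by positivity)
  refine ⟨C', hC', ?_⟩
  intro ρ₀ u₀ hρc huc hρs hus ε hε hq0 hq1 T ρ u hsol T₁ hT₁ hT₁T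
  have h := hsol.solvesOn hγ hT₁T
  have hρ0 : ∀ x, R < x → ρ₀ x = 0 := fun x hx => eq_zero_of_tsupport_subset hρs hx
  have hu0 : ∀ x, R < x → u₀ x = 0 := fun x hx => eq_zero_of_tsupport_subset hus hx
  have hrest : ∀ t ∈ Icc 0 T₁, ∀ x, R + t < x → ρ x t = 1 ∧ u x t = 0 := fun t ht x hx =>
    h.eq_rest hγ (by linarith) hT₁
      (fun x hx => by rw [hsol.initial_density, hρ0 x hx]; simp)
      (fun x hx => by rw [hsol.initial_velocity, hu0 x hx]; simp) ht hx
  have hB := B0_pos hR hρc hρ0 hq0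
  refine hlog κ T₁ _ (fun t => ∫ x in R₀..(R + T₁), mainDensity κ R₀ Φ ρ u x t)
    (fun t => ∫ x in R₀..(R + T₁), waveDensity κ R₀ Φ ρ x t)
    (fun t => ∫ x in R₀..(R + T₁), waveTimeDensity κ R₀ Φ ρ x t) hκ0 hκ1 hT₁
    (by positivity) (min_le_left _ _)
    (continuousOn_integral_closedStrip hT₁ (h.continuousOn_mainDensity hΦ))
    (continuousOn_integral_closedStrip hT₁ (h.continuousOn_waveDensity hΦ)) ?_
    (fun t ht => h.hasDerivAt_waveFunctional hΦ hrest ht) ?_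
  · intro t ht
    obtain ⟨hnn, hθ⟩ := h.le_integral_production hγ hκ0 hκ1 hR hC.le hΦ hq hc ha hexc hrest
      (Ioo_subset_Icc_self ht)
    refine ⟨_, h.hasDerivAt_main hγ hΦ hrest ht, hnn, fun θ hθ0 => ?_⟩
    have hb := hθ θ hθ0
    have hτ : 0 < 1 + t := by linarith [ht.1]
    -- the weaker factor `1 / (1 + t)` serves all `κ ≤ 1` at once
    have hw : 1 / (1 + t) ≤ (1 + t) ^ (-κ) := by
      rw [one_div, ← Real.rpow_neg_one]
      exact Real.rpow_le_rpow_of_exponent_le (by linarith [ht.1]) (by linarith)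
    rcases le_total 0 (θ * (|∫ x in R₀..(R + T₁), waveDensity κ R₀ Φ ρ x t|
        + |∫ x in R₀..(R + T₁), waveTimeDensity κ R₀ Φ ρ x t|)
        - c * C * (R - R₀) ^ 3 * (a ^ 2 + a ^ q) * (θ ^ 2 + θ ^ q)) with hs | hs
    · exact (mul_le_mul_of_nonneg_right hw hs).trans hb
    · exact (mul_nonpos_of_nonneg_of_nonpos (by positivity) hs).trans hnn
  · exact (min_le_right _ _).trans (le_main_zero hΦ hR hT₁ hε hρc huc hρ0 hu0
      hsol.initial_density hsol.initial_velocity hq0 hq1)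

end DampedEuler

theorem theorem1p2 (γ μ R₀ R : ℝ) (hγ : 1 < γ) (hμ0 : 0 ≤ μ) (hμ2 : μ ≤ 2)
    (hR₀ : 0 < R₀) (hR : R₀ < R) :
    ∃ C : ℝ, 0 < C ∧
      ∀ ρ₀ u₀ : ℝ → ℝ, ContDiff ℝ ∞ ρ₀ → ContDiff ℝ ∞ u₀ →
        tsupport ρ₀ ⊆ Set.Icc (-R) R → tsupport u₀ ⊆ Set.Icc (-R) R →
        ∀ ε : ℝ, 0 < ε → (∀ x : ℝ, 0 < 1 + ε * ρ₀ x) →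
          (∀ r ∈ Set.Ioo R₀ R, 0 < DampedEuler.q0 ρ₀ r) →
          (∀ r ∈ Set.Ioo R₀ R, 0 ≤ DampedEuler.q1 ε ρ₀ u₀ r) →
          DampedEuler.lifespan γ μ ε ρ₀ u₀ < ⊤ ∧
          (γ = 2 → DampedEuler.lifespan γ μ ε ρ₀ u₀ ≤
            ENNReal.ofReal (C * Real.exp (C / (ε ^ 2 * DampedEuler.B0 R₀ R ρ₀ ^ 2)))) := by
  obtain ⟨C, hC, hbound⟩ := DampedEuler.exists_lifespan_bound (γ := γ) (κ := μ / 2) hγ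
    (by linarith) (by linarith) hR
  refine ⟨Real.exp (2 * C) + C, by positivity, ?_⟩
  intro ρ₀ u₀ hρ hu hρs hus ε hε _ hq0 hq1
  have hB := DampedEuler.B0_pos hR hρ.continuous
    (fun x hx => DampedEuler.eq_zero_of_tsupport_subset hρs hx) hq0
  -- the bound does not depend on `γ = 2`, and in particular shows that the lifespan is finite
  suffices hle : DampedEuler.lifespan γ μ ε ρ₀ u₀ ≤ ENNReal.ofReal ((Real.exp (2 * C) + C)
      * Real.exp ((Real.exp (2 * C) + C) / (ε ^ 2 * DampedEuler.B0 R₀ R ρ₀ ^ 2))) from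
    ⟨lt_of_le_of_lt hle ENNReal.ofReal_lt_top, fun _ => hle⟩
  refine sSup_le ?_
  rintro T ⟨ρ, u, hsol⟩
  by_contra! hlt
  rw [show μ = 2 * (μ / 2) by ring] at hsol
  -- `D` exceeds both the prefactor `exp (2 C)` and the exponent `C`, because one constant has to
  -- serve in both places
  set D := Real.exp (2 * C) + C with hD
  set v := ε * DampedEuler.B0 R₀ R ρ₀ with hv
  have hv0 : 0 < v := by positivity
  have hv2 : ε ^ 2 * DampedEuler.B0 R₀ R ρ₀ ^ 2 = v ^ 2 := by rw [hv]; ring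
  rw [hv2] at hlt
  have hE := Real.exp_pos (2 * C)
  have hb := hbound ρ₀ u₀ hρ.continuous hu.continuous hρs hus ε hε hq0 hq1 T ρ u hsol
    (D * Real.exp (D / v ^ 2)) (by positivity) hlt
  have hmin : C / min 1 (v / 2) ≤ 2 * C + C / v ^ 2 := by
    have h1 : 1 / min 1 (v / 2) ≤ 2 + 1 / v ^ 2 := by
      have hi : 0 < 1 / v := by positivity
      have e : 1 / v ^ 2 = (1 / v) ^ 2 := by rw [one_div_pow]
      rcases min_choice 1 (v / 2) with h | h <;> rw [h, e]
      · nlinarith [sq_nonneg (1 / v)]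
      · rw [one_div_div, show 2 / v = 2 * (1 / v) by ring]
        nlinarith [sq_nonneg (1 / v - 1)]
    calc C / min 1 (v / 2) = C * (1 / min 1 (v / 2)) := by ring
      _ ≤ C * (2 + 1 / v ^ 2) := by gcongr
      _ = _ := by ring
  have h2 := hb.trans hmin
  rw [Real.log_le_iff_le_exp (by positivity), Real.exp_add] at h2
  have h3 : Real.exp (2 * C) * Real.exp (C / v ^ 2) ≤ D * Real.exp (D / v ^ 2) := by
    have : Real.exp (C / v ^ 2) ≤ Real.exp (D / v ^ 2) := by
      apply Real.exp_le_exp.2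
      gcongr
      linarith
    have : Real.exp (2 * C) ≤ D := by linarith
    gcongr
  linarith
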